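/- Let $K$ be a field, complete with respect to an ultrametric norm $|\cdot|$, whose residue field is infinite and whose value group $|K^*|\subset\mathbb{R}_{>0}$ is not discrete. *The Berkovich projective line.* Write $\mathbb{P}^1_K=K\sqcup\{\infty\}$. An open ball of $\mathbb{P}^1_K$ is a set $\{z\in K:|z-a|<r\}$, or the complement in $\mathbb{P}^1_K$ of a set $\{z\in K:|z-a|\le r\}$, with $a\in K$ and $r\in|K^*|$; an open affinoid is a finite intersection of open balls. The sets $\bigcup_{Y\in C}Y\times Y$, where $C$ runs over the finite covers of $\mathbb{P}^1_K$ by open affinoids, form a base of a uniform structure on $\mathbb{P}^1_K$. Its separated completion $\mathsf{P}^1_K$ (whose points are the minimal Cauchy filters on $\mathbb{P}^1_K$) is the Berkovich projective line; the topology of this completion is the *weak topology*. *The tree.* Let $\mathcal{A}_K$ be the completion of the space of points $[x,r]$ ($x\in K$, $r\ge 0$, with $[x,r]=[x',r']$ if and only if $r=r'\ge|x-x'|$) for the distance $\delta([x,r],[x',r'])=\max\{r,r',|x-x'|\}-\tfrac12(r+r')$. Let $\operatorname{diam}$, $|\cdot|$ and $\sup\{\cdot,\cdot\}$ be the continuous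 extensions to $\mathcal{A}_K$ of $\operatorname{diam}[x,r]=r$, $|[x,r]|=\max\{|x|,r\}$ and $\sup\{[x,r],[x',r']\}=\max\{r,r',|x-x'|\}$. The set $\mathcal{A}'_K=\mathcal{A}_K\sqcup\{\infty\}$, with the distance $$\Delta(S,T)=\frac{\sup\{S,T\}}{\max\{1,|S|\}\max\{1,|T|\}}-\frac{\operatorname{diam}S}{2\max\{1,|S|\}^2}-\frac{\operatorname{diam}T}{2\max\{1,|T|\}^2}\qquad(S,T\in\mathcal{A}_K),$$ $$\Delta(S,\infty)=\frac{1}{\max\{1,|S|\}}-\frac{\operatorname{diam}S}{2\max\{1,|S|\}^2},$$ is a real tree. *The identification.* Let $\iota:\mathcal{A}'_K\to\mathsf{P}^1_K$ be the map that sends $S$ to the minimal Cauchy filter coarser than the Cauchy filter generated by the open balls of $\mathbb{P}^1_K$ whose corresponding open ball of $\mathcal{A}'_K$ contains $S$. Here $\{z:|z-a|<r\}$ corresponds to $\{S\in\mathcal{A}_K:\sup\{S,a\}<r\}$, and the complement of $\{z:|z-a|\le r\}$ corresponds to the complement of $\{S\in\mathcal{A}_K:\sup\{S,a\}\le r\}$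 (with $a=[a,0]$). It is the unique continuous map that sends each $[a,r]$ with $r>0$ to the minimal Cauchy filter $\mathfrak{F}$ for which the intersection of the balls of $K$ belonging to $\mathfrak{F}$ is $\{z:|z-a|\le r\}$; it is a bijection, by which $\mathcal{A}'_K$ and $\mathsf{P}^1_K$ are identified. The *fine topology* on $\mathsf{P}^1_K$ is the topology of $(\mathcal{A}'_K,\Delta)$ transported by $\iota$, the *geodesic segments* of $\mathsf{P}^1_K$ are the images by $\iota$ of the geodesic segments $[S,T]$ of the real tree $(\mathcal{A}'_K,\Delta)$, and a subset of $\mathsf{P}^1_K$ is *convex* if it contains the geodesic segment joining any two of its points. **Corollary.** The weak topology and the fine topology induce the same topology on every geodesic segment of $\mathsf{P}^1_K$. Consequently, for a subset $V\subset\mathsf{P}^1_K$ the following are equivalent: 1. $V$ is convex; 2. $V$ is connected for the fine topology; 3. $V$ is connected for the weak topology. In particular, for each of the two topologies, every connected subset of $\mathsf{P}^1_K$ is arc-connected (any two distinct points of it are joined by a topological arc contained in it), and every intersection of connected subsets of $\mathsf{P}^1_K$ is connected. (The empty set is regarded as connected.) -/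

import Mathlib

namespace BerkovichLine

open Set Filter Topology UniformSpace

/-! ## The tree of an ultrametric field -/

/-- Pairs `(x, r)` with `x ∈ K` and `r ≥ 0`, standing for the ball `{z | ‖z - x‖ ≤ r}`. -/
structure BallPair (K : Type*) where
  center : K
  radius : ℝ
  radius_nonneg : 0 ≤ radius

section Tree

variable {K : Type*} [NormedField K]

/-- `sup {[x, r], [x', r']} = max {r, r', ‖x - x'‖}`. -/
noncomputable def BallPair.sup (p q : BallPair K) : ℝ :=
  max (max p.radius q.radius) ‖p.center - q.center‖

theorem BallPair.sup_self (p : BallPair K) : p.sup p = p.radius := by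
  simp [BallPair.sup, p.radius_nonneg]

theorem BallPair.sup_comm (p q : BallPair K) : p.sup q = q.sup p := by
  simp only [BallPair.sup, norm_sub_rev p.center, max_comm p.radius]

variable [IsUltrametricDist K]

theorem BallPair.sup_triangle (p q s : BallPair K) : p.sup s ≤ max (p.sup q) (q.sup s) := by
  have h : ‖p.center - s.center‖ ≤ max ‖p.center - q.center‖ ‖q.center - s.center‖ := by
    simpa using IsUltrametricDist.norm_add_le_max (p.center - q.center) (q.center - s.center)
  refine max_le (max_le ?_ ?_) (h.trans (max_le_max (le_max_right _ _) (le_max_right _ _)))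
  · exact le_max_of_le_left ((le_max_left _ _).trans (le_max_left _ _))
  · exact le_max_of_le_right ((le_max_right _ _).trans (le_max_left _ _))

/-- The distance `δ([x, r], [x', r']) = max {r, r', ‖x - x'‖} - (r + r') / 2`.
Two pairs are at distance `0` if and only if `r = r' ≥ ‖x - x'‖`. -/
noncomputable instance : PseudoMetricSpace (BallPair K) where
  dist p q := p.sup q - (p.radius + q.radius) / 2
  dist_self p := by simp [BallPair.sup_self]
  dist_comm p q := by rw [BallPair.sup_comm, add_comm p.radius]
  dist_triangle p q s := by
    have h1 : q.radius ≤ p.sup q := (le_max_right _ _).trans (le_max_left _ _)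
    have h2 : q.radius ≤ q.sup s := (le_max_left _ _).trans (le_max_left _ _)
    rcases le_max_iff.1 (BallPair.sup_triangle p q s) with h | h <;> linarith

theorem BallPair.dist_def (p q : BallPair K) :
    dist p q = p.sup q - (p.radius + q.radius) / 2 := rfl

theorem BallPair.dist_eq_zero_iff (p q : BallPair K) :
    dist p q = 0 ↔ p.radius = q.radius ∧ ‖p.center - q.center‖ ≤ p.radius := by
  have h1 : p.radius ≤ p.sup q := (le_max_left _ _).trans (le_max_left _ _)
  have h2 : q.radius ≤ p.sup q := (le_max_right _ _).trans (le_max_left _ _)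
  have h3 : ‖p.center - q.center‖ ≤ p.sup q := le_max_right _ _
  rw [BallPair.dist_def]
  constructor
  · intro h
    constructor <;> linarith
  · rintro ⟨h, h'⟩
    have : p.sup q = p.radius := le_antisymm (by simp [BallPair.sup, h', ← h]) h1
    linarith

/-- The real tree `𝒜_K`: the completion, for the distance `δ`, of the space of the points `[x, r]`,
that is, of the pairs `(x, r)` modulo `r = r' ≥ ‖x - x'‖` (the completion of a pseudometric space
identifies the points that are at distance `0`). -/
abbrev Tree (K : Type*) [NormedField K] [IsUltrametricDist K] : Type _ :=
  Completion (BallPair K)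

namespace Tree

/-- The point `[x, r]` of the tree. -/
noncomputable def mk (x : K) (r : ℝ) (hr : 0 ≤ r) : Tree K :=
  ((⟨x, r, hr⟩ : BallPair K) : Completion (BallPair K))

/-- The point `[x, 0]` of the tree, identified with `x ∈ K`. -/
noncomputable def ofField (x : K) : Tree K := mk x 0 le_rfl

/-- The continuous extension of `diam [x, r] = r` to the tree. -/
noncomputable def diam : Tree K → ℝ :=
  Completion.extension (fun p : BallPair K => p.radius)

/-- The continuous extension of `sup {[x, r], [x', r']} = max {r, r', ‖x - x'‖}` to the tree. It
satisfies `δ(S, T) = sup {S, T} - (diam S + diam T) / 2`. -/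
noncomputable def sup (S T : Tree K) : ℝ := dist S T + (diam S + diam T) / 2

/-- The continuous extension of `|[x, r]| = max {‖x‖, r}` to the tree. -/
noncomputable def abs (S : Tree K) : ℝ := sup S (ofField 0)

theorem uniformContinuous_radius : UniformContinuous (fun p : BallPair K => p.radius) := by
  refine LipschitzWith.uniformContinuous (K := 2) (LipschitzWith.of_dist_le_mul fun p q => ?_)
  have h1 : p.radius ≤ p.sup q := (le_max_left _ _).trans (le_max_left _ _)
  have h2 : q.radius ≤ p.sup q := (le_max_right _ _).trans (le_max_left _ _)
  rw [Real.dist_eq, BallPair.dist_def, abs_le]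
  constructor <;> push_cast <;> linarith

@[fun_prop]
theorem continuous_diam : Continuous (diam : Tree K → ℝ) := Completion.continuous_extension

theorem diam_coe (p : BallPair K) : diam (p : Tree K) = p.radius :=
  Completion.extension_coe uniformContinuous_radius p

theorem sup_coe (p q : BallPair K) : sup (p : Tree K) (q : Tree K) = p.sup q := by
  rw [sup, diam_coe, diam_coe, Completion.dist_eq, BallPair.dist_def]
  ring

theorem abs_mk (x : K) (r : ℝ) (hr : 0 ≤ r) : abs (mk x r hr) = max ‖x‖ r := by
  rw [abs, ofField, mk, mk, sup_coe]
  simp [BallPair.sup, hr, max_comm]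

@[fun_prop]
theorem continuous_sup {X : Type*} [TopologicalSpace X] {f g : X → Tree K} (hf : Continuous f)
    (hg : Continuous g) : Continuous fun x => sup (f x) (g x) := by
  unfold sup
  fun_prop

@[fun_prop]
theorem continuous_abs : Continuous (abs : Tree K → ℝ) := by
  unfold abs
  fun_prop

theorem sup_self (S : Tree K) : sup S S = diam S := by simp [sup]

theorem sup_comm (S T : Tree K) : sup S T = sup T S := by
  rw [sup, sup, dist_comm, add_comm (diam S)]

theorem diam_nonneg (S : Tree K) : 0 ≤ diam S := by
  refine Completion.induction_on S (isClosed_le continuous_const continuous_diam) fun p => ?_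
  rw [diam_coe]
  exact p.radius_nonneg

theorem sup_triangle (S T U : Tree K) : sup S U ≤ max (sup S T) (sup T U) := by
  refine Completion.induction_on₃ S T U (isClosed_le (by fun_prop) (by fun_prop)) fun p q s => ?_
  simp only [sup_coe]
  exact BallPair.sup_triangle p q s

theorem diam_le_sup (S T : Tree K) : diam S ≤ sup S T := by
  have := sup_triangle S T S
  rwa [sup_comm T S, max_self, sup_self] at this

theorem max_one_abs (S : Tree K) : max 1 (abs S) = sup S (mk 0 1 zero_le_one) := by
  refine Completion.induction_on S (isClosed_eq (by fun_prop) (by fun_prop)) fun p => ?_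
  rw [abs, ofField, mk, mk, sup_coe, sup_coe]
  simp only [BallPair.sup, max_eq_left p.radius_nonneg, max_assoc]
  exact max_left_comm _ _ _

/-- The ultrametric four-point inequality. -/
theorem sup_mul_sup_le (S T U V : Tree K) :
    sup S U * sup T V ≤ max (sup S T * sup U V) (sup T U * sup S V) := by
  have nn : ∀ A B : Tree K, 0 ≤ sup A B := fun A B => (diam_nonneg A).trans (diam_le_sup A B)
  have h1 := sup_triangle S T U
  have h2 := sup_triangle T U V
  have h3 := sup_triangle T S V
  have h4 := sup_triangle S V U
  rw [sup_comm T S] at h3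
  rw [sup_comm V U] at h4
  have := nn S U
  have := nn T V
  have := nn S T
  have := nn U V
  have := nn T U
  have := nn S V
  simp only [le_max_iff] at h1 h2 h3 h4 ⊢
  rcases h1 with h1 | h1
  · rcases h2 with h2 | h2
    · rcases h3 with h3 | h3
      · rcases h4 with h4 | h4
        · right; calc
            _ ≤ sup S V * sup T U := by gcongr
            _ = _ := mul_comm _ _
        · left; calc
            _ ≤ sup U V * sup S T := by gcongr
            _ = _ := mul_comm _ _
      · rcases h4 with h4 | h4
        · right; calc
            _ ≤ sup S V * sup T U := by gcongr
            _ = _ := mul_comm _ _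
        · rcases le_total (sup S V) (sup U V) with h | h
          · left; exact mul_le_mul h1 (h3.trans h) ‹_› ‹_›
          · right; calc
            _ ≤ sup S V * sup T U := by gcongr; exact h4.trans h
            _ = _ := mul_comm _ _
    · left; exact mul_le_mul h1 h2 ‹_› ‹_›
  · rcases h3 with h3 | h3
    · rcases h2 with h2 | h2
      · rcases h4 with h4 | h4
        · right; calc
            _ ≤ sup S V * sup T U := by gcongr
            _ = _ := mul_comm _ _
        · left; calc
            _ ≤ sup U V * sup S T := by gcongr
            _ = _ := mul_comm _ _
      · rcases h4 with h4 | h4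
        · rcases le_total (sup S V) (sup U V) with h | h
          · left; calc
            _ ≤ sup U V * sup S T := by gcongr; exact h4.trans h
            _ = _ := mul_comm _ _
          · right; exact mul_le_mul h1 (h2.trans h) ‹_› ‹_›
        · left; calc
            _ ≤ sup U V * sup S T := by gcongr
            _ = _ := mul_comm _ _
    · right; exact mul_le_mul h1 h3 ‹_› ‹_›

end Tree

/-- The projective tree `𝒜'_K = 𝒜_K ⊔ {∞}`. -/
inductive ProjTree (K : Type*) [NormedField K] [IsUltrametricDist K] : Type _
  | infty : ProjTree K
  | of (S : Tree K) : ProjTree K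

namespace ProjTree

/-- `sup {S, T} / (max {1, |S|} * max {1, |T|})`, extended by continuity to `∞`. -/
noncomputable def chordalSup : ProjTree K → ProjTree K → ℝ
  | infty, infty => 0
  | infty, of T => 1 / max 1 T.abs
  | of S, infty => 1 / max 1 S.abs
  | of S, of T => S.sup T / (max 1 S.abs * max 1 T.abs)

/-- The chordal distance
`Δ(S, T) = sup {S, T} / (max {1, |S|} * max {1, |T|}) - diam S / (2 * max {1, |S|} ^ 2)
  - diam T / (2 * max {1, |T|} ^ 2)`,
extended by continuity to `∞`. -/
noncomputable def chordalDist (S T : ProjTree K) : ℝ :=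
  chordalSup S T - chordalSup S S / 2 - chordalSup T T / 2

theorem chordalDist_of_of (S T : Tree K) :
    chordalDist (of S) (of T) = S.sup T / (max 1 S.abs * max 1 T.abs)
      - S.diam / (2 * max 1 S.abs ^ 2) - T.diam / (2 * max 1 T.abs ^ 2) := by
  simp only [chordalDist, chordalSup, Tree.sup_self]
  have h1 : max 1 S.abs ≠ 0 := (lt_max_of_lt_left one_pos).ne'
  have h2 : max 1 T.abs ≠ 0 := (lt_max_of_lt_left one_pos).ne'
  field_simp

theorem chordalDist_of_infty (S : Tree K) :
    chordalDist (of S) infty = 1 / max 1 S.abs - S.diam / (2 * max 1 S.abs ^ 2) := by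
  simp only [chordalDist, chordalSup, Tree.sup_self]
  have h1 : max 1 S.abs ≠ 0 := (lt_max_of_lt_left one_pos).ne'
  field_simp
  ring

theorem chordalSup_comm (S T : ProjTree K) : chordalSup S T = chordalSup T S := by
  cases S <;> cases T <;> simp only [chordalSup, Tree.sup_comm, mul_comm]

theorem chordalSup_triangle (S T U : ProjTree K) :
    chordalSup S U ≤ max (chordalSup S T) (chordalSup T U) := by
  have hpos : ∀ A : Tree K, 0 < max 1 A.abs := fun A => lt_max_of_lt_left one_pos
  have key : ∀ A B : Tree K, max 1 A.abs ≤ max (A.sup B) (max 1 B.abs) := fun A B => by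
    rw [Tree.max_one_abs, Tree.max_one_abs]
    exact Tree.sup_triangle _ _ _
  have nn : ∀ A B : Tree K, 0 ≤ A.sup B := fun A B =>
    (Tree.diam_nonneg A).trans (Tree.diam_le_sup A B)
  cases S with
  | infty =>
    cases U with
    | infty => cases T <;> simp [chordalSup, (hpos _).le]
    | of U =>
      cases T with
      | infty => simp [chordalSup]
      | of T =>
        simp only [chordalSup]
        have := hpos U
        have := hpos T
        rcases le_max_iff.1 (key T U) with h | h
        · apply le_max_of_le_right
          rw [div_le_div_iff₀ (by positivity) (by positivity)]
          nlinarith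
        · apply le_max_of_le_left
          gcongr
  | of S =>
    have := hpos S
    cases U with
    | infty =>
      cases T with
      | infty => simp [chordalSup]
      | of T =>
        simp only [chordalSup]
        have := hpos T
        rcases le_max_iff.1 (key T S) with h | h
        · apply le_max_of_le_left
          rw [div_le_div_iff₀ (by positivity) (by positivity)]
          rw [Tree.sup_comm] at h
          nlinarith
        · apply le_max_of_le_right
          gcongr
    | of U =>
      have := hpos U
      cases T with
      | infty =>
        simp only [chordalSup]
        have h : S.sup U ≤ max (max 1 S.abs) (max 1 U.abs) := by
          rw [Tree.max_one_abs, Tree.max_one_abs, Tree.sup_comm U]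
          exact Tree.sup_triangle _ _ _
        rcases le_max_iff.1 h with h | h
        · apply le_max_of_le_right
          rw [div_le_div_iff₀ (by positivity) (by positivity)]
          nlinarith
        · apply le_max_of_le_left
          rw [div_le_div_iff₀ (by positivity) (by positivity)]
          nlinarith
      | of T =>
        simp only [chordalSup]
        have := hpos T
        have h := Tree.sup_mul_sup_le S T U (Tree.mk 0 1 zero_le_one)
        simp only [← Tree.max_one_abs] at h
        rcases le_max_iff.1 h with h | h
        · apply le_max_of_le_left
          rw [div_le_div_iff₀ (by positivity) (by positivity)]
          nlinarith
        · apply le_max_of_le_right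
          rw [div_le_div_iff₀ (by positivity) (by positivity)]
          nlinarith

theorem chordalSup_self_le (S T : ProjTree K) : chordalSup S S ≤ chordalSup S T := by
  have := chordalSup_triangle S T S
  rwa [chordalSup_comm T S, max_self] at this

theorem eq_of_chordalDist_eq_zero (S T : ProjTree K) (h : chordalDist S T = 0) : S = T := by
  have h1 := chordalSup_self_le S T
  have h2 := chordalSup_self_le T S
  rw [chordalSup_comm T S] at h2
  have e1 : chordalSup S T = chordalSup S S := by unfold chordalDist at h; linarith
  have e2 : chordalSup S T = chordalSup T T := by unfold chordalDist at h; linarith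
  have hpos : ∀ A : Tree K, 0 < max 1 A.abs := fun A => lt_max_of_lt_left one_pos
  cases S with
  | infty =>
    cases T with
    | infty => rfl
    | of T =>
      simp only [chordalSup] at e1
      exact absurd e1 (one_div_pos.2 (hpos T)).ne'
  | of S =>
    cases T with
    | infty =>
      simp only [chordalSup] at e2
      exact absurd e2 (one_div_pos.2 (hpos S)).ne'
    | of T =>
      simp only [chordalSup, Tree.sup_self] at e1 e2
      have hS := hpos S
      have hT := hpos T
      rw [div_eq_div_iff (by positivity) (by positivity)] at e1 e2
      have a1 : S.sup T * max 1 S.abs = S.diam * max 1 T.abs := by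
        apply mul_right_cancel₀ hS.ne'; linarith
      have a2 : S.sup T * max 1 T.abs = T.diam * max 1 S.abs := by
        apply mul_right_cancel₀ hT.ne'; linarith
      have d1 := Tree.diam_le_sup S T
      have d2 := Tree.diam_le_sup T S
      rw [Tree.sup_comm T S] at d2
      have n1 := Tree.diam_nonneg S
      have n2 := Tree.diam_nonneg T
      have hd : dist S T = S.sup T - (S.diam + T.diam) / 2 := by rw [Tree.sup]; ring
      congr 1
      rw [← dist_eq_zero, hd]
      rcases le_total (max 1 S.abs) (max 1 T.abs) with hle | hle
      · have : S.sup T ≤ T.diam := by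
          refine le_of_mul_le_mul_right ?_ hT
          rw [a2]
          gcongr
        have : S.sup T ≤ S.diam := by
          have hTT : T.diam = S.sup T := le_antisymm d2 this
          rcases n2.eq_or_lt with h0 | h0
          · linarith
          · have : max 1 T.abs = max 1 S.abs := by
              apply mul_left_cancel₀ h0.ne'
              rw [← a2, hTT]
            rw [this] at a1
            exact (mul_right_cancel₀ hS.ne' a1).le
        linarith
      · have : S.sup T ≤ S.diam := by
          refine le_of_mul_le_mul_right ?_ hS
          rw [a1]
          gcongr
        have : S.sup T ≤ T.diam := by
          have hSS : S.diam = S.sup T := le_antisymm d1 this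
          rcases n1.eq_or_lt with h0 | h0
          · linarith
          · have : max 1 S.abs = max 1 T.abs := by
              apply mul_left_cancel₀ h0.ne'
              rw [← a1, hSS]
            rw [this] at a2
            exact (mul_right_cancel₀ hT.ne' a2).le
        linarith

noncomputable instance : MetricSpace (ProjTree K) where
  dist := chordalDist
  dist_self S := by simp only [chordalDist]; ring
  dist_comm S T := by simp only [chordalDist, chordalSup_comm S T]; ring
  dist_triangle S T U := by
    have h1 := chordalSup_self_le T S
    have h2 := chordalSup_self_le T U
    rw [chordalSup_comm T S] at h1
    simp only [chordalDist]
    rcases le_max_iff.1 (chordalSup_triangle S T U) with h | h <;> linarith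
  eq_of_dist_eq_zero := eq_of_chordalDist_eq_zero _ _

end ProjTree

end Tree

/-! ## The base field -/

section Field

variable (K : Type*) [NormedField K]

/-- The value group `|K*|`. -/
def valueGroup : Set ℝ := {r | ∃ x : K, x ≠ 0 ∧ ‖x‖ = r}

/-- The standing assumptions on the ultrametric field `K`: the residue field is infinite and the
value group is not discrete. -/
class AdmissibleField [IsUltrametricDist K] : Prop where
  infinite_residueField :
    Infinite (IsLocalRing.ResidueField (NormedField.valuation (K := K)).valuationSubring)
  not_discrete_valueGroup : ¬ DiscreteTopology (valueGroup K)

variable {K}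

theorem pos_of_mem_valueGroup {r : ℝ} (hr : r ∈ valueGroup K) : 0 < r := by
  obtain ⟨x, hx, rfl⟩ := hr
  exact norm_pos_iff.2 hx

theorem norm_sub_le_max' [IsUltrametricDist K] (x y : K) : ‖x - y‖ ≤ max ‖x‖ ‖y‖ := by
  simpa [sub_eq_add_neg] using IsUltrametricDist.norm_add_le_max x (-y)

variable [IsUltrametricDist K] [AdmissibleField K]

theorem exists_norm_mem_Ioo_one {q : ℝ} (hq : 1 < q) : ∃ x : K, 1 < ‖x‖ ∧ ‖x‖ < q := by
  by_contra! H
  refine AdmissibleField.not_discrete_valueGroup (K := K) ?_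
  rw [discreteTopology_iff_isOpen_singleton]
  rintro ⟨v, hv⟩
  have hvpos := pos_of_mem_valueGroup hv
  rw [Metric.isOpen_singleton_iff]
  refine ⟨v * (1 - 1 / q), mul_pos hvpos ?_, ?_⟩
  · rw [sub_pos, div_lt_one (by linarith)]
    exact hq
  rintro ⟨w, hw⟩ hd
  have hwpos := pos_of_mem_valueGroup hw
  obtain ⟨x, hx, rfl⟩ := hv
  obtain ⟨y, hy, rfl⟩ := hw
  rw [Subtype.dist_eq, Real.dist_eq, abs_lt] at hd
  have hq1 : 1 - 1 / q < q - 1 := by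
    have : 0 < q := by linarith
    rw [← sub_pos, show q - 1 - (1 - 1 / q) = (q - 1) ^ 2 / q by field_simp]
    have : 0 < q - 1 := by linarith
    positivity
  ext
  change ‖y‖ = ‖x‖
  rcases lt_trichotomy ‖y‖ ‖x‖ with h | h | h
  · exfalso
    have h1 : 1 < ‖x / y‖ := by rwa [norm_div, one_lt_div hwpos]
    have h2 := H _ h1
    rw [norm_div, le_div_iff₀ hwpos] at h2
    have h3 : ‖x‖ / q < ‖y‖ := by
      have := hd.1
      simp only at this
      have e : ‖x‖ * (1 - 1 / q) = ‖x‖ - ‖x‖ / q := by ring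
      linarith
    rw [div_lt_iff₀ (by linarith)] at h3
    linarith
  · exact h
  · exfalso
    have h1 : 1 < ‖y / x‖ := by rwa [norm_div, one_lt_div hvpos]
    have h2 := H _ h1
    rw [norm_div, le_div_iff₀ hvpos] at h2
    have := hd.2
    simp only at this
    nlinarith

/-- The value group is dense in the positive reals. -/
theorem exists_mem_valueGroup {s t : ℝ} (hs : 0 < s) (hst : s < t) :
    ∃ r ∈ valueGroup K, s < r ∧ r < t := by
  obtain ⟨x, hx1, hx2⟩ := exists_norm_mem_Ioo_one (K := K) ((one_lt_div hs).2 hst)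
  obtain ⟨n, hn1, hn2⟩ := exists_mem_Ico_zpow hs hx1
  have hx0 : x ≠ 0 := norm_pos_iff.1 (zero_lt_one.trans hx1)
  refine ⟨‖x‖ ^ (n + 1), ⟨x ^ (n + 1), zpow_ne_zero _ hx0, norm_zpow _ _⟩, hn2, ?_⟩
  rw [zpow_add_one₀ (norm_ne_zero_iff.2 hx0)]
  rw [lt_div_iff₀ hs] at hx2
  have : ‖x‖ ^ n * ‖x‖ ≤ s * ‖x‖ := by gcongr
  linarith

/-- A closed ball is not covered by finitely many open balls of at most the same radius. -/
theorem exists_mem_closedBall_forall_le {A : Set K} (hA : A.Finite) (b : K) {s : ℝ}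
    (hs : s ∈ valueGroup K) : ∃ x : K, ‖x - b‖ ≤ s ∧ ∀ a ∈ A, s ≤ ‖x - a‖ := by
  obtain ⟨c, hc, rfl⟩ := hs
  have hcpos : 0 < ‖c‖ := norm_pos_iff.2 hc
  let O := (NormedField.valuation (K := K)).valuationSubring
  have := AdmissibleField.infinite_residueField (K := K)
  have hfin : {ρ : IsLocalRing.ResidueField O |
      ∃ u : O, (u : K) ∈ (fun a => (a - b) / c) '' A ∧ IsLocalRing.residue O u = ρ}.Finite := by
    refine ((hA.image fun a => (a - b) / c).preimage
      (Subtype.val_injective (p := fun x => x ∈ O)).injOn).image (IsLocalRing.residue O) |>.subset ?_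
    rintro ρ ⟨u, hu, rfl⟩
    exact ⟨u, hu, rfl⟩
  obtain ⟨ρ, hρ⟩ := hfin.exists_notMem
  obtain ⟨y, rfl⟩ := IsLocalRing.residue_surjective ρ
  have hmem : ∀ u : K, u ∈ O ↔ ‖u‖ ≤ 1 := fun u => by
    rw [Valuation.mem_valuationSubring_iff, NormedField.valuation_apply]
    exact Iff.rfl
  have hy : ‖(y : K)‖ ≤ 1 := (hmem _).1 y.2
  refine ⟨b + c * y, by simpa using mul_le_of_le_one_right (norm_nonneg c) hy, fun a ha => ?_⟩
  have e : b + c * (y : K) - a = c * (y - (a - b) / c) := by field_simp; ring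
  rw [e, norm_mul]
  refine le_mul_of_one_le_right (norm_nonneg c) ?_
  by_contra! hlt
  have hu : ‖(a - b) / c‖ ≤ 1 := by
    have := norm_sub_le_max' (y : K) (y - (a - b) / c)
    rw [sub_sub_cancel] at this
    exact this.trans (max_le hy hlt.le)
  let u : O := ⟨(a - b) / c, (hmem _).2 hu⟩
  refine hρ ⟨u, ⟨a, ha, rfl⟩, ?_⟩
  rw [eq_comm, ← sub_eq_zero, ← map_sub, IsLocalRing.residue_eq_zero_iff,
    Valuation.mem_maximalIdeal_iff]
  exact hlt

end Field

/-! ## The projective line and its open balls -/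

section Line

/-- The projective line `ℙ¹_K = K ⊔ {∞}`. -/
def ProjLine (K : Type*) : Type _ := OnePoint K

section

variable {K : Type*}

/-- The inclusion of `K` in the projective line. -/
def ProjLine.ofField (x : K) : ProjLine K := (x : OnePoint K)

/-- The point `∞` of the projective line. -/
def ProjLine.infty : ProjLine K := (OnePoint.infty : OnePoint K)

theorem ProjLine.ofField_injective : Function.Injective (ProjLine.ofField (K := K)) :=
  OnePoint.coe_injective

theorem ProjLine.infty_ne_ofField (x : K) : (ProjLine.infty : ProjLine K) ≠ ProjLine.ofField x :=
  OnePoint.infty_ne_coe x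

theorem ProjLine.cases (z : ProjLine K) : z = ProjLine.infty ∨ ∃ x, z = ProjLine.ofField x := by
  induction z using OnePoint.rec with
  | infty => exact Or.inl rfl
  | coe x => exact Or.inr ⟨x, rfl⟩

/-- The set `V(C) = ⋃ Y ∈ C, Y × Y`. -/
def coverEntourage (C : Set (Set (ProjLine K))) : Set (ProjLine K × ProjLine K) :=
  ⋃ Y ∈ C, Y ×ˢ Y

theorem mem_coverEntourage {C : Set (Set (ProjLine K))} {x y : ProjLine K} :
    (x, y) ∈ coverEntourage C ↔ ∃ Y ∈ C, x ∈ Y ∧ y ∈ Y := by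
  simp only [coverEntourage, mem_iUnion, mem_prod, exists_prop]

end

variable {K : Type*} [NormedField K]

variable (K) in
/-- An open ball of the projective line, with radius in the value group: either the ball
`{z ∈ K | ‖z - center‖ < radius}` (when `outer = false`), or the complement in `ℙ¹_K` of the ball
`{z ∈ K | ‖z - center‖ ≤ radius}` (when `outer = true`). -/
structure OpenBall where
  center : K
  radius : ℝ
  radius_mem : radius ∈ valueGroup K
  outer : Bool

namespace OpenBall

instance : Nonempty (OpenBall K) := ⟨⟨0, 1, ⟨1, one_ne_zero, norm_one⟩, false⟩⟩

/-- The subset of the projective line defined by an open ball. -/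
def toSet : OpenBall K → Set (ProjLine K)
  | ⟨a, r, _, false⟩ => ProjLine.ofField '' {z | ‖z - a‖ < r}
  | ⟨a, r, _, true⟩ => (ProjLine.ofField '' {z | ‖z - a‖ ≤ r})ᶜ

/-- The open ball of the projective tree which corresponds to an open ball of the projective line:
either `{S ∈ 𝒜_K | sup {S, center} < radius}`, or the complement in `𝒜'_K` of
`{S ∈ 𝒜_K | sup {S, center} ≤ radius}`. -/
def treeSet [IsUltrametricDist K] : OpenBall K → Set (ProjTree K)
  | ⟨a, r, _, false⟩ => ProjTree.of '' {S | S.sup (Tree.ofField a) < r}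
  | ⟨a, r, _, true⟩ => (ProjTree.of '' {S | S.sup (Tree.ofField a) ≤ r})ᶜ

end OpenBall

/-- An open affinoid: a finite intersection of open balls. -/
def IsOpenAffinoid (Y : Set (ProjLine K)) : Prop :=
  ∃ J : Set (OpenBall K), J.Finite ∧ Y = ⋂ D ∈ J, D.toSet

/-- A finite cover of the projective line by open affinoids. -/
structure IsAffinoidCover (C : Set (Set (ProjLine K))) : Prop where
  finite : C.Finite
  isOpenAffinoid : ∀ Y ∈ C, IsOpenAffinoid Y
  sUnion_eq : ⋃₀ C = univ

namespace OpenBall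

variable {a x : K} {r : ℝ} {hr : r ∈ valueGroup K}

@[simp] theorem ofField_mem_inner :
    ProjLine.ofField x ∈ (⟨a, r, hr, false⟩ : OpenBall K).toSet ↔ ‖x - a‖ < r := by
  simp [toSet, ProjLine.ofField_injective.eq_iff]

@[simp] theorem ofField_mem_outer :
    ProjLine.ofField x ∈ (⟨a, r, hr, true⟩ : OpenBall K).toSet ↔ r < ‖x - a‖ := by
  simp [toSet, ProjLine.ofField_injective.eq_iff]

@[simp] theorem infty_notMem_inner :
    ProjLine.infty ∉ (⟨a, r, hr, false⟩ : OpenBall K).toSet := by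
  simp [toSet, (ProjLine.infty_ne_ofField _).symm]

@[simp] theorem infty_mem_outer :
    ProjLine.infty ∈ (⟨a, r, hr, true⟩ : OpenBall K).toSet := by
  simp [toSet, (ProjLine.infty_ne_ofField _).symm]

/-- A combinatorial condition for two open balls to cover the projective line. -/
def Covers (t : ℝ) : OpenBall K → OpenBall K → Prop
  | ⟨b, s, _, true⟩, ⟨a, r, _, false⟩ => s * t < r / t ∧ ‖a - b‖ < r / t
  | ⟨b, s, _, true⟩, ⟨b', s', _, true⟩ => s * t < ‖b - b'‖ ∧ s' * t < ‖b - b'‖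
  | _, _ => False

/-- The condition for two open balls to cover the projective line is an open one. -/
theorem Covers.eventually {D D' : OpenBall K} (h : Covers 1 D D') :
    ∀ᶠ t in 𝓝[>] (1 : ℝ), Covers t D D' := by
  obtain ⟨b, s, hs, o⟩ := D
  obtain ⟨a, r, hr, o'⟩ := D'
  have c1 : ∀ u : ℝ, Tendsto (fun t : ℝ => u * t) (𝓝[>] 1) (𝓝 (u * 1)) := fun u =>
    (tendsto_id.const_mul u).mono_left nhdsWithin_le_nhds
  have c2 : Tendsto (fun t : ℝ => r / t) (𝓝[>] 1) (𝓝 (r / 1)) :=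
    (tendsto_const_nhds.div tendsto_id one_ne_zero).mono_left nhdsWithin_le_nhds
  cases o <;> cases o' <;> simp only [Covers] at h ⊢
  · exact ((c1 s).eventually_lt c2 h.1).and (tendsto_const_nhds.eventually_lt c2 h.2)
  · exact ((c1 s).eventually_lt tendsto_const_nhds h.1).and
      ((c1 r).eventually_lt tendsto_const_nhds h.2)

variable [IsUltrametricDist K]

@[simp] theorem of_mem_inner {S : Tree K} :
    ProjTree.of S ∈ (⟨a, r, hr, false⟩ : OpenBall K).treeSet ↔ S.sup (Tree.ofField a) < r := by
  simp [treeSet]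

@[simp] theorem of_mem_outer {S : Tree K} :
    ProjTree.of S ∈ (⟨a, r, hr, true⟩ : OpenBall K).treeSet ↔ r < S.sup (Tree.ofField a) := by
  simp [treeSet]

@[simp] theorem tree_infty_notMem_inner :
    ProjTree.infty ∉ (⟨a, r, hr, false⟩ : OpenBall K).treeSet := by
  simp [treeSet]

@[simp] theorem tree_infty_mem_outer :
    ProjTree.infty ∈ (⟨a, r, hr, true⟩ : OpenBall K).treeSet := by
  simp [treeSet]

theorem Covers.treeSet {D D' : OpenBall K} (h : Covers 1 D D') (S : ProjTree K) :
    S ∈ D.treeSet ∨ S ∈ D'.treeSet := by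
  obtain ⟨b, s, hs, o⟩ := D
  obtain ⟨a, r, hr, o'⟩ := D'
  have hnorm : ∀ x y : K, (Tree.ofField x).sup (Tree.ofField y) = ‖x - y‖ := fun x y => by
    rw [Tree.ofField, Tree.ofField, Tree.mk, Tree.mk, Tree.sup_coe]
    simp [BallPair.sup]
  cases o <;> cases o' <;> simp only [Covers, mul_one, div_one] at h
  · cases S with
    | infty => simp
    | of S =>
      by_contra! hS
      simp only [of_mem_inner, of_mem_outer, not_lt] at hS
      have := Tree.sup_triangle S (Tree.ofField b) (Tree.ofField a)
      rw [hnorm, norm_sub_rev] at this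
      rcases le_max_iff.1 this with h' | h' <;> linarith [h.1, h.2]
  · cases S with
    | infty => simp
    | of S =>
      by_contra! hS
      simp only [of_mem_outer, not_lt] at hS
      have := Tree.sup_triangle (Tree.ofField b) S (Tree.ofField a)
      rw [hnorm, Tree.sup_comm] at this
      rcases le_max_iff.1 this with h' | h' <;> linarith [h.1, h.2]

/-- Among finitely many open balls covering the projective line, two already cover it. -/
theorem exists_covers [AdmissibleField K] {J : Set (OpenBall K)} (hJ : J.Finite)
    (hcov : ∀ z : ProjLine K, ∃ D ∈ J, z ∈ D.toSet) : ∃ D ∈ J, ∃ D' ∈ J, Covers 1 D D' := by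
  by_contra! H
  have hne : {D ∈ J | D.outer = true}.Nonempty := by
    obtain ⟨⟨a, r, hr, o⟩, hD, hz⟩ := hcov ProjLine.infty
    cases o
    · simp at hz
    · exact ⟨_, hD, rfl⟩
  obtain ⟨⟨b, s, hs, o⟩, ⟨hD, ho⟩, hmin⟩ :=
    exists_min_image _ OpenBall.radius (hJ.subset (sep_subset _ _)) hne
  simp only at ho
  subst ho
  obtain ⟨x, hx, hxa⟩ := exists_mem_closedBall_forall_le (hJ.image OpenBall.center) b hs
  obtain ⟨⟨a, r, hr, o⟩, hD', hz⟩ := hcov (ProjLine.ofField x)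
  have hH := H _ hD _ hD'
  cases o
  · simp only [ofField_mem_inner, Covers, mul_one, div_one, not_and, not_lt] at hz hH
    have hsr : s < r := (hxa a ⟨_, hD', rfl⟩).trans_lt hz
    refine absurd (hH hsr) (not_le.2 ?_)
    have := norm_sub_le_max' (x - b) (x - a)
    rw [sub_sub_sub_cancel_left] at this
    exact this.trans_lt (max_lt (hx.trans_lt hsr) hz)
  · simp only [ofField_mem_outer, Covers, mul_one, not_and, not_lt] at hz hH
    have hsr : s ≤ r := hmin _ ⟨hD', rfl⟩
    have hba : ‖b - a‖ ≤ r := by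
      by_contra! h
      linarith [hH (hsr.trans_lt h)]
    have := IsUltrametricDist.norm_add_le_max (x - b) (b - a)
    rw [sub_add_sub_cancel] at this
    linarith [this.trans (max_le (hx.trans hsr) hba)]

/-- A ball slightly larger than the complement of an open ball. -/
theorem exists_flip [AdmissibleField K] {t : ℝ} (ht : 1 < t) : ∃ E : OpenBall K → OpenBall K,
    (∀ D z, z ∈ D.toSet ∨ z ∈ (E D).toSet) ∧
    ∀ D D', Covers t D D' → ∀ z, z ∈ (E D).toSet → z ∉ (E D').toSet := by
  have ht0 : 0 < t := by linarith
  have h1 : ∀ D : OpenBall K, ∃ ρ ∈ valueGroup K, D.radius / t < ρ ∧ ρ < D.radius := fun D =>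
    have := pos_of_mem_valueGroup D.radius_mem
    exists_mem_valueGroup (by positivity) (div_lt_self this ht)
  have h2 : ∀ D : OpenBall K, ∃ ρ ∈ valueGroup K, D.radius < ρ ∧ ρ < D.radius * t := fun D =>
    have := pos_of_mem_valueGroup D.radius_mem
    exists_mem_valueGroup this (lt_mul_of_one_lt_right this ht)
  choose f hf hf1 hf2 using h1
  choose g hg hg1 hg2 using h2
  refine ⟨fun D => match D.outer with
    | false => ⟨D.center, f D, hf D, true⟩
    | true => ⟨D.center, g D, hg D, false⟩, ?_, ?_⟩
  · rintro ⟨a, r, hr, o⟩ z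
    rcases z.cases with rfl | ⟨x, rfl⟩
    · cases o <;> simp
    · cases o
      · simp only [ofField_mem_inner, ofField_mem_outer]
        have := hf2 ⟨a, r, hr, false⟩
        simp only at this
        by_contra! h
        linarith [h.1, h.2]
      · simp only [ofField_mem_inner, ofField_mem_outer]
        have := hg1 ⟨a, r, hr, true⟩
        simp only at this
        by_contra! h
        linarith [h.1, h.2]
  · rintro ⟨b, s, hs, o⟩ ⟨a, r, hr, o'⟩ h z
    rcases z.cases with rfl | ⟨x, rfl⟩
    · cases o <;> cases o' <;> simp [Covers] at h ⊢
    · cases o <;> cases o' <;> simp only [Covers] at h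
      · have e1 := hg2 ⟨b, s, hs, true⟩
        have e2 := hf1 ⟨a, r, hr, false⟩
        simp only [ofField_mem_inner, ofField_mem_outer, not_lt] at e1 e2 ⊢
        intro hz
        have := IsUltrametricDist.norm_add_le_max (x - b) (b - a)
        rw [sub_add_sub_cancel, norm_sub_rev b a] at this
        exact this.trans (max_le (by linarith [h.1]) (by linarith [h.2]))
      · have e1 := hg2 ⟨b, s, hs, true⟩
        have e2 := hg2 ⟨a, r, hr, true⟩
        simp only [ofField_mem_inner, not_lt] at e1 e2 ⊢
        intro hz
        by_contra! hz'
        have := norm_sub_le_max' (x - a) (x - b)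
        rw [sub_sub_sub_cancel_left] at this
        exact absurd this (not_le.2 (max_lt (by linarith [h.2]) (by linarith [h.1])))

end OpenBall

theorem isAffinoidCover_univ : IsAffinoidCover ({univ} : Set (Set (ProjLine K))) where
  finite := finite_singleton _
  isOpenAffinoid := by
    rintro Y rfl
    exact ⟨∅, finite_empty, by simp⟩
  sUnion_eq := by simp

theorem IsAffinoidCover.inter {C C' : Set (Set (ProjLine K))} (hC : IsAffinoidCover C)
    (hC' : IsAffinoidCover C') : IsAffinoidCover (image2 (· ∩ ·) C C') where
  finite := hC.finite.image2 _ hC'.finite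
  isOpenAffinoid := by
    rintro _ ⟨Y, hY, Y', hY', rfl⟩
    obtain ⟨J, hJ, rfl⟩ := hC.isOpenAffinoid Y hY
    obtain ⟨J', hJ', rfl⟩ := hC'.isOpenAffinoid Y' hY'
    exact ⟨J ∪ J', hJ.union hJ', by rw [biInter_union]⟩
  sUnion_eq := by
    refine eq_univ_of_forall fun z => ?_
    obtain ⟨Y, hY, hz⟩ := hC.sUnion_eq.symm ▸ mem_univ z
    obtain ⟨Y', hY', hz'⟩ := hC'.sUnion_eq.symm ▸ mem_univ z
    exact ⟨_, mem_image2_of_mem hY hY', hz, hz'⟩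

variable (K) in
/-- The filter of entourages: the sets which contain `V(C)` for some finite cover `C` of `ℙ¹_K` by
open affinoids. -/
def affinoidUniformity : Filter (ProjLine K × ProjLine K) where
  sets := {V | ∃ C, IsAffinoidCover C ∧ coverEntourage C ⊆ V}
  univ_sets := ⟨_, isAffinoidCover_univ, subset_univ _⟩
  sets_of_superset := fun ⟨C, hC, h⟩ h' => ⟨C, hC, h.trans h'⟩
  inter_sets := by
    rintro V V' ⟨C, hC, h⟩ ⟨C', hC', h'⟩
    refine ⟨_, hC.inter hC', ?_⟩
    rintro ⟨x, y⟩ hxy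
    obtain ⟨_, ⟨Y, hY, Y', hY', rfl⟩, hx, hy⟩ := mem_coverEntourage.1 hxy
    exact ⟨h (mem_coverEntourage.2 ⟨Y, hY, hx.1, hy.1⟩),
      h' (mem_coverEntourage.2 ⟨Y', hY', hx.2, hy.2⟩)⟩

theorem mem_affinoidUniformity {V : Set (ProjLine K × ProjLine K)} :
    V ∈ affinoidUniformity K ↔ ∃ C, IsAffinoidCover C ∧ coverEntourage C ⊆ V := Iff.rfl

variable [IsUltrametricDist K] [AdmissibleField K]

/-- If a ball is chosen for each element of a cover by affinoids, two of these balls cover `ℙ¹_K`. -/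
theorem IsAffinoidCover.exists_covers {C : Set (Set (ProjLine K))} (hC : IsAffinoidCover C)
    {P : OpenBall K → Prop}
    (h : ∀ Y ∈ C, ∃ D : OpenBall K, Y ⊆ D.toSet ∧ P D) :
    ∃ D D', P D ∧ P D' ∧ OpenBall.Covers 1 D D' := by
  choose! D hYD hP using h
  obtain ⟨_, ⟨Y, hY, rfl⟩, _, ⟨Y', hY', rfl⟩, hc⟩ :=
    OpenBall.exists_covers (hC.finite.image D) fun z => by
      obtain ⟨Y, hY, hz⟩ := hC.sUnion_eq.symm ▸ mem_univ z
      exact ⟨D Y, mem_image_of_mem D hY, hYD Y hY hz⟩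
  exact ⟨_, _, hP Y hY, hP Y' hY', hc⟩

theorem exists_comp_subset {C : Set (Set (ProjLine K))} (hC : IsAffinoidCover C) :
    ∃ W ∈ affinoidUniformity K, ∀ x y z, (x, y) ∈ W → (y, z) ∈ W → (x, z) ∈ coverEntourage C := by
  have hJ := hC.isOpenAffinoid
  choose! J hJfin hJ using hJ
  have hfin : (⋃ Y ∈ C, J Y).Finite := hC.finite.biUnion hJfin
  have hev : ∀ᶠ t in 𝓝[>] (1 : ℝ), ∀ D ∈ ⋃ Y ∈ C, J Y, ∀ D' ∈ ⋃ Y ∈ C, J Y,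
      OpenBall.Covers 1 D D' → OpenBall.Covers t D D' := by
    rw [eventually_all_finite hfin]
    intro D _
    rw [eventually_all_finite hfin]
    intro D' _
    by_cases h : OpenBall.Covers 1 D D'
    · simpa [h] using h.eventually
    · simp [h]
  obtain ⟨t, ht, ht1⟩ := (hev.and self_mem_nhdsWithin).exists
  obtain ⟨E, hE1, hE2⟩ := OpenBall.exists_flip (K := K) (t := t) ht1
  let C' : Set (ProjLine K) → Set (Set (ProjLine K)) := fun Y =>
    insert Y ((fun D => (E D).toSet) '' J Y)
  have hC' : ∀ Y ∈ C, IsAffinoidCover (C' Y) := fun Y hY =>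
    { finite := ((hJfin Y hY).image _).insert _
      isOpenAffinoid := by
        rintro Z (rfl | ⟨D, -, rfl⟩)
        · exact hC.isOpenAffinoid _ hY
        · exact ⟨{E D}, finite_singleton _, by simp⟩
      sUnion_eq := by
        refine eq_univ_of_forall fun z => ?_
        by_cases hz : z ∈ Y
        · exact ⟨Y, mem_insert _ _, hz⟩
        · rw [hJ Y hY] at hz
          simp only [mem_iInter, not_forall] at hz
          obtain ⟨D, hD, hz⟩ := hz
          exact ⟨_, mem_insert_of_mem _ ⟨D, hD, rfl⟩, (hE1 D z).resolve_left hz⟩ }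
  refine ⟨⋂ Y ∈ C, coverEntourage (C' Y), (biInter_mem hC.finite).2 fun Y hY =>
    ⟨C' Y, hC' Y hY, Subset.rfl⟩, fun x y z hxy hyz => ?_⟩
  have key : ∃ Y ∈ C, ∀ D ∈ J Y, y ∉ (E D).toSet := by
    by_contra! H
    obtain ⟨D, D', ⟨hD, hyD⟩, ⟨hD', hyD'⟩, hc⟩ := hC.exists_covers
      (P := fun D => D ∈ ⋃ Y ∈ C, J Y ∧ y ∈ (E D).toSet) fun Y hY => by
        obtain ⟨D, hD, hy⟩ := H Y hY
        refine ⟨D, ?_, mem_biUnion hY hD, hy⟩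
        rw [hJ Y hY]
        exact biInter_subset_of_mem hD
    exact hE2 D D' (ht D hD D' hD' hc) y hyD hyD'
  obtain ⟨Y, hY, hy⟩ := key
  have h1 := mem_iInter₂.1 hxy Y hY
  have h2 := mem_iInter₂.1 hyz Y hY
  obtain ⟨Z, hZ, hx, hyZ⟩ := mem_coverEntourage.1 h1
  obtain ⟨Z', hZ', hyZ', hz⟩ := mem_coverEntourage.1 h2
  have e1 : Z = Y := by
    rcases hZ with rfl | ⟨D, hD, rfl⟩
    · rfl
    · exact absurd hyZ (hy D hD)
  have e2 : Z' = Y := by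
    rcases hZ' with rfl | ⟨D, hD, rfl⟩
    · rfl
    · exact absurd hyZ' (hy D hD)
  subst e1 e2
  exact mem_coverEntourage.2 ⟨_, hY, hx, hz⟩

/-- The uniform structure on the projective line defined by the finite covers by open affinoids. -/
instance : UniformSpace (ProjLine K) := UniformSpace.ofCore
  { uniformity := affinoidUniformity K
    refl := by
      rintro V ⟨C, hC, hV⟩ ⟨x, y⟩ (rfl : x = y)
      obtain ⟨Y, hY, hx⟩ := hC.sUnion_eq.symm ▸ mem_univ x
      exact hV (mem_coverEntourage.2 ⟨Y, hY, hx, hx⟩)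
    symm := by
      rintro V ⟨C, hC, hV⟩
      refine ⟨C, hC, ?_⟩
      rintro ⟨x, y⟩ hxy
      obtain ⟨Y, hY, hx, hy⟩ := mem_coverEntourage.1 hxy
      exact hV (mem_coverEntourage.2 ⟨Y, hY, hy, hx⟩)
    comp := by
      rintro V ⟨C, hC, hV⟩
      obtain ⟨W, hW, h⟩ := exists_comp_subset hC
      refine mem_of_superset (mem_lift' hW) ?_
      rintro ⟨x, z⟩ ⟨y, hxy, hyz⟩
      exact hV (h x y z hxy hyz) }

theorem mem_uniformity_projLine {V : Set (ProjLine K × ProjLine K)} :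
    V ∈ uniformity (ProjLine K) ↔ ∃ C, IsAffinoidCover C ∧ coverEntourage C ⊆ V := Iff.rfl

variable (K) in
/-- The Berkovich projective line: the separated completion of the projective line for the uniform
structure of the finite covers by open affinoids. -/
abbrev BerkLine : Type _ := Completion (ProjLine K)

end Line

/-! ## The identification of the tree with the Berkovich projective line -/

section Identification

variable {K : Type*} [NormedField K] [IsUltrametricDist K]

/-- The filter on the projective line generated by the open balls whose corresponding ball of the
projective tree contains `S`. -/
def ballFilter (S : ProjTree K) : Filter (ProjLine K) :=
  Filter.generate {B | ∃ D : OpenBall K, S ∈ D.treeSet ∧ B = D.toSet}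

theorem biInter_mem_ballFilter {S : ProjTree K} {J : Set (OpenBall K)} (hJ : J.Finite)
    (h : ∀ D ∈ J, S ∈ D.treeSet) : ⋂ D ∈ J, D.toSet ∈ ballFilter S :=
  (biInter_mem hJ).2 fun D hD => Filter.GenerateSets.basic ⟨D, h D hD, rfl⟩

theorem ProjTree.continuous_chordalSup (T : ProjTree K) :
    Continuous fun S => ProjTree.chordalSup S T := by
  have h : ∀ S T : ProjTree K, ProjTree.chordalSup S T =
      dist S T + (ProjTree.chordalSup S S + ProjTree.chordalSup T T) / 2 := fun S T => by
    change _ = ProjTree.chordalDist S T + _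
    rw [ProjTree.chordalDist]
    ring
  have hself : Continuous fun S : ProjTree K => ProjTree.chordalSup S S := by
    refine (LipschitzWith.of_dist_le_mul (K := 2) fun S T => ?_).continuous
    have h1 := ProjTree.chordalSup_self_le S T
    have h2 := ProjTree.chordalSup_self_le T S
    rw [ProjTree.chordalSup_comm T S] at h2
    have := h S T
    rw [Real.dist_eq, abs_le]
    constructor <;> push_cast <;> linarith
  have e : (fun S => ProjTree.chordalSup S T) = fun S =>
      dist S T + (ProjTree.chordalSup S S + ProjTree.chordalSup T T) / 2 := funext fun S => h S T
  rw [e]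
  fun_prop

theorem isOpen_treeSet (D : OpenBall K) : IsOpen D.treeSet := by
  obtain ⟨a, r, hr, o⟩ := D
  have hr0 := pos_of_mem_valueGroup hr
  set A := ProjTree.of (Tree.ofField a)
  have c1 := ProjTree.continuous_chordalSup A
  have c2 := (ProjTree.continuous_chordalSup (ProjTree.infty : ProjTree K)).const_mul
    (r * ProjTree.chordalSup A ProjTree.infty)
  have hpos : ∀ T : Tree K, 0 < max 1 T.abs := fun T => lt_max_of_lt_left one_pos
  have hA := hpos (Tree.ofField a)
  have e : ∀ S : Tree K, r * ProjTree.chordalSup A ProjTree.infty *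
      ProjTree.chordalSup (ProjTree.of S) ProjTree.infty =
      r / (max 1 S.abs * max 1 (Tree.ofField a).abs) := fun S => by
    simp only [A, ProjTree.chordalSup]
    have := hpos S
    field_simp
  cases o
  · convert isOpen_lt c1 c2 using 1
    ext S
    cases S with
    | infty =>
      simp only [OpenBall.tree_infty_notMem_inner, false_iff, mem_ofPred_eq, not_lt]
      simp only [A, ProjTree.chordalSup, mul_zero]
      positivity
    | of S =>
      rw [OpenBall.of_mem_inner, mem_ofPred_eq, e]
      simp only [A, ProjTree.chordalSup]
      have := hpos S
      rw [div_lt_div_iff_of_pos_right (by positivity)]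
  · convert isOpen_lt c2 c1 using 1
    ext S
    cases S with
    | infty =>
      simp only [OpenBall.tree_infty_mem_outer, true_iff, mem_ofPred_eq]
      simp only [A, ProjTree.chordalSup, mul_zero]
      positivity
    | of S =>
      rw [OpenBall.of_mem_outer, mem_ofPred_eq, e]
      simp only [A, ProjTree.chordalSup]
      have := hpos S
      rw [div_lt_div_iff_of_pos_right (by positivity)]

theorem exists_finite_of_mem_ballFilter {S : ProjTree K} {U : Set (ProjLine K)}
    (hU : U ∈ ballFilter S) : ∃ J : Set (OpenBall K), J.Finite ∧ (∀ D ∈ J, S ∈ D.treeSet) ∧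
      ⋂ D ∈ J, D.toSet ⊆ U := by
  obtain ⟨t, ht, htfin, htU⟩ := Filter.mem_generate_iff.1 hU
  choose! D hD1 hD2 using ht
  refine ⟨D '' t, htfin.image D, ?_, ?_⟩
  · rintro _ ⟨B, hB, rfl⟩
    exact hD1 hB
  · intro z hz
    refine htU fun B hB => ?_
    rw [hD2 hB]
    exact mem_iInter₂.1 hz _ (mem_image_of_mem D hB)

variable [AdmissibleField K]

theorem OpenBall.exists_flip_of_mem {S : ProjTree K} {D : OpenBall K} (hS : S ∈ D.treeSet) :
    ∃ D' E : OpenBall K, S ∈ D'.treeSet ∧ S ∉ E.treeSet ∧ (∀ z, z ∈ D.toSet ∨ z ∈ E.toSet) ∧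
      ∀ z, z ∈ D'.toSet → z ∉ E.toSet := by
  obtain ⟨a, r, hr, o⟩ := D
  cases o
  · cases S with
    | infty => simp at hS
    | of S =>
      rw [of_mem_inner] at hS
      have h0 : 0 ≤ S.sup (Tree.ofField a) := (Tree.diam_nonneg S).trans (Tree.diam_le_sup _ _)
      obtain ⟨ρ, hρ, h1, h2⟩ := exists_mem_valueGroup (K := K)
        (lt_max_of_lt_right (half_pos (pos_of_mem_valueGroup hr)))
        (max_lt hS (half_lt_self (pos_of_mem_valueGroup hr)))
      have h1 := (le_max_left _ _).trans_lt h1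
      refine ⟨⟨a, ρ, hρ, false⟩, ⟨a, ρ, hρ, true⟩, by simpa, by simpa using h1.le, ?_, ?_⟩
      · intro z
        rcases z.cases with rfl | ⟨x, rfl⟩
        · simp
        · simp only [ofField_mem_inner, ofField_mem_outer]
          by_contra! h
          linarith [h.1, h.2]
      · intro z
        rcases z.cases with rfl | ⟨x, rfl⟩
        · simp
        · simp only [ofField_mem_inner, ofField_mem_outer]
          exact fun h => h.le.not_gt
  · have : ∃ ρ ∈ valueGroup K, r < ρ ∧ ∀ hρ, S ∈ (⟨a, ρ, hρ, true⟩ : OpenBall K).treeSet ∧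
        S ∉ (⟨a, ρ, hρ, false⟩ : OpenBall K).treeSet := by
      cases S with
      | infty =>
        obtain ⟨ρ, hρ, h1, -⟩ := exists_mem_valueGroup (K := K) (pos_of_mem_valueGroup hr)
          (lt_add_one r)
        exact ⟨ρ, hρ, h1, by simp⟩
      | of S =>
        rw [of_mem_outer] at hS
        obtain ⟨ρ, hρ, h1, h2⟩ := exists_mem_valueGroup (K := K) (pos_of_mem_valueGroup hr) hS
        exact ⟨ρ, hρ, h1, by simp [h2, h2.le]⟩
    obtain ⟨ρ, hρ, h1, h2⟩ := this
    refine ⟨⟨a, ρ, hρ, true⟩, ⟨a, ρ, hρ, false⟩, (h2 hρ).1, (h2 hρ).2, ?_, ?_⟩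
    · intro z
      rcases z.cases with rfl | ⟨x, rfl⟩
      · simp
      · simp only [ofField_mem_inner, ofField_mem_outer]
        by_contra! h
        linarith [h.1, h.2]
    · intro z
      rcases z.cases with rfl | ⟨x, rfl⟩
      · simp
      · simp only [ofField_mem_inner, ofField_mem_outer]
        exact fun h => h.le.not_gt

theorem exists_mem_of_mem_treeSet {S : ProjTree K} {J J' : Set (OpenBall K)} (hJ : J.Finite)
    (hJ' : J'.Finite) (h : ∀ D ∈ J, S ∈ D.treeSet) (h' : ∀ D ∈ J', S ∉ D.treeSet) :
    ∃ z, (∀ D ∈ J, z ∈ D.toSet) ∧ ∀ D ∈ J', z ∉ D.toSet := by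
  choose! D₁ E h1 h2 h3 h4 using fun (D : OpenBall K) (hD : D ∈ J) =>
    OpenBall.exists_flip_of_mem (h D hD)
  by_contra! H
  have hnot : ∀ D ∈ E '' J ∪ J', S ∉ D.treeSet := by
    rintro _ (⟨D, hD, rfl⟩ | hD)
    · exact h2 D hD
    · exact h' _ hD
  obtain ⟨D, hD, D', hD', hc⟩ := OpenBall.exists_covers ((hJ.image E).union hJ') fun z => by
    by_cases hz : ∀ D ∈ J, z ∈ D.toSet
    · obtain ⟨D, hD, hzD⟩ := H z hz
      exact ⟨D, Or.inr hD, hzD⟩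
    · push Not at hz
      obtain ⟨D, hD, hz⟩ := hz
      exact ⟨E D, Or.inl ⟨D, hD, rfl⟩, (h3 D hD z).resolve_left hz⟩
  exact (hc.treeSet S).elim (hnot D hD) (hnot D' hD')

instance ballFilter_neBot (S : ProjTree K) : (ballFilter S).NeBot := by
  refine ⟨fun h => ?_⟩
  obtain ⟨J, hJ, hS, hJU⟩ := exists_finite_of_mem_ballFilter (h ▸ Filter.mem_bot : ∅ ∈ ballFilter S)
  obtain ⟨z, hz, -⟩ := exists_mem_of_mem_treeSet hJ finite_empty hS (by simp)
  exact hJU (mem_iInter₂.2 hz)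

theorem IsAffinoidCover.exists_treeSet {C : Set (Set (ProjLine K))} (hC : IsAffinoidCover C)
    (S : ProjTree K) : ∃ J : Set (OpenBall K), J.Finite ∧ ⋂ D ∈ J, D.toSet ∈ C ∧
      ∀ D ∈ J, S ∈ D.treeSet := by
  by_contra! H
  obtain ⟨D, D', hD, hD', hc⟩ := hC.exists_covers (P := fun D => S ∉ D.treeSet) fun Y hY => by
    obtain ⟨J, hJ, rfl⟩ := hC.isOpenAffinoid Y hY
    obtain ⟨D, hD, hS⟩ := H J hJ hY
    exact ⟨D, biInter_subset_of_mem hD, hS⟩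
  exact (hc.treeSet S).elim hD hD'

theorem cauchy_ballFilter (S : ProjTree K) : Cauchy (ballFilter S) := by
  refine ⟨inferInstance, ?_⟩
  rintro V ⟨C, hC, hV⟩
  obtain ⟨J, hJ, hY, hS⟩ := hC.exists_treeSet S
  have hmem := biInter_mem_ballFilter hJ hS
  refine mem_of_superset (prod_mem_prod hmem hmem) ?_
  rintro ⟨x, y⟩ ⟨hx, hy⟩
  exact hV (mem_coverEntourage.2 ⟨_, hY, hx, hy⟩)

/-- The identification `ι` of the projective tree with the Berkovich projective line: the point `S`
is sent to the limit of the Cauchy filter generated by the open balls of `ℙ¹_K` whose corresponding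
ball of the tree contains `S`. It is the continuous map that sends `[a, r]`, with `r > 0`, to the
point determined by the ball `{z ∈ K | ‖z - a‖ ≤ r}`, see `continuous_iota` and
`residualBall_iota` below. -/
noncomputable def iota (S : ProjTree K) : BerkLine K :=
  SeparationQuotient.mk (⟨ballFilter S, cauchy_ballFilter S⟩ : CauchyFilter (ProjLine K))

/-- The minimal Cauchy filter on the projective line given by a point of the completion. -/
def minimalFilter (p : BerkLine K) : Filter (ProjLine K) := Filter.comap (↑) (𝓝 p)

/-- The intersection `B_F` of all balls of `K` that belong to the minimal Cauchy filter `F`. -/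
def residualBall (p : BerkLine K) : Set K :=
  {z | ∀ (b : K) (ρ : ℝ), 0 < ρ → ∀ B, (B = {x | ‖x - b‖ < ρ} ∨ B = {x | ‖x - b‖ ≤ ρ}) →
    ProjLine.ofField '' B ∈ minimalFilter p → z ∈ B}

theorem mem_minimalFilter_iota {S : ProjTree K} {U : Set (ProjLine K)} :
    U ∈ minimalFilter (iota S) ↔ ∃ C, IsAffinoidCover C ∧
      ∀ y, {x | (x, y) ∈ coverEntourage C} ∈ ballFilter S → y ∈ U := by
  set f : CauchyFilter (ProjLine K) := ⟨ballFilter S, cauchy_ballFilter S⟩ with hf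
  have e : minimalFilter (iota S) = Filter.comap CauchyFilter.pureCauchy (𝓝 f) := by
    exact Filter.comap_comap.symm.trans
      (congrArg (Filter.comap CauchyFilter.pureCauchy) SeparationQuotient.comap_mk_nhds_mk)
  have hprod : ∀ (V : Set (ProjLine K × ProjLine K)) (y : ProjLine K),
      V ∈ f.1 ×ˢ (CauchyFilter.pureCauchy y).1 ↔ {x | (x, y) ∈ V} ∈ ballFilter S := fun V y => by
    change V ∈ ballFilter S ×ˢ pure y ↔ _
    rw [prod_pure, mem_map]
    rfl
  rw [e, UniformSpace.nhds_eq_comap_uniformity, Filter.comap_comap, mem_comap]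
  constructor
  · rintro ⟨s, hs, hsU⟩
    obtain ⟨V, ⟨C, hC, hCV⟩, hV⟩ := CauchyFilter.mem_uniformity'.1 hs
    refine ⟨C, hC, fun y hy => hsU (hV f _ ?_)⟩
    exact mem_of_superset ((hprod _ y).2 hy) hCV
  · rintro ⟨C, hC, h⟩
    refine ⟨CauchyFilter.gen (coverEntourage C), CauchyFilter.mem_uniformity'.2
      ⟨coverEntourage C, ⟨C, hC, Subset.rfl⟩, fun _ _ h => h⟩, fun y hy => ?_⟩
    exact h y ((hprod _ y).1 hy)

theorem ballFilter_le_minimalFilter (S : ProjTree K) :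
    ballFilter S ≤ minimalFilter (iota S) := by
  intro U hU
  obtain ⟨C, hC, h⟩ := mem_minimalFilter_iota.1 hU
  obtain ⟨J, hJ, hY, hS⟩ := hC.exists_treeSet S
  have hmem := biInter_mem_ballFilter hJ hS
  refine mem_of_superset hmem fun y hy => h y (mem_of_superset hmem fun x hx => ?_)
  exact mem_coverEntourage.2 ⟨_, hY, hx, hy⟩

/-- The identification preserves the correspondence between open balls. -/
theorem toSet_mem_minimalFilter_iota {S : ProjTree K} {D : OpenBall K} :
    D.toSet ∈ minimalFilter (iota S) ↔ S ∈ D.treeSet := by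
  constructor
  · intro hD
    by_contra hS
    obtain ⟨J, hJ, hJS, hJD⟩ := exists_finite_of_mem_ballFilter (ballFilter_le_minimalFilter S hD)
    obtain ⟨z, hz, hz'⟩ := exists_mem_of_mem_treeSet hJ (finite_singleton D) hJS (by simpa)
    exact hz' D rfl (hJD (mem_iInter₂.2 hz))
  · intro hS
    obtain ⟨D', E, hD', -, hcov, hdisj⟩ := OpenBall.exists_flip_of_mem hS
    have hD'mem : D'.toSet ∈ ballFilter S := Filter.GenerateSets.basic ⟨D', hD', rfl⟩
    refine mem_minimalFilter_iota.2 ⟨{D.toSet, E.toSet}, ⟨by simp, ?_, ?_⟩, fun y hy => ?_⟩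
    · rintro Y (rfl | rfl)
      · exact ⟨{D}, finite_singleton _, by simp⟩
      · exact ⟨{E}, finite_singleton _, by simp⟩
    · refine eq_univ_of_forall fun z => ?_
      simpa using hcov z
    · obtain ⟨x, hx, hx'⟩ := (ballFilter_neBot S).nonempty_of_mem (inter_mem hy hD'mem)
      obtain ⟨Z, hZ, hxZ, hyZ⟩ := mem_coverEntourage.1 hx
      rcases hZ with rfl | rfl
      · exact hyZ
      · exact absurd hxZ (hdisj x hx')

theorem continuous_iota : Continuous (iota (K := K)) := by
  refine SeparationQuotient.continuous_mk.comp (continuous_iff_continuousAt.2 fun S => ?_)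
  refine Uniform.tendsto_nhds_right.2 fun s hs => ?_
  obtain ⟨V, ⟨C, hC, hCV⟩, hV⟩ := CauchyFilter.mem_uniformity'.1 hs
  obtain ⟨J, hJ, hY, hS⟩ := hC.exists_treeSet S
  have hopen : ∀ᶠ T in 𝓝 S, ∀ D ∈ J, T ∈ D.treeSet :=
    (eventually_all_finite hJ).2 fun D hD => (isOpen_treeSet D).mem_nhds (hS D hD)
  rw [mem_map]
  refine mem_of_superset hopen fun T hT => ?_
  refine hV _ _ (mem_of_superset
    (prod_mem_prod (biInter_mem_ballFilter hJ hS) (biInter_mem_ballFilter hJ hT)) ?_)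
  rintro ⟨x, y⟩ ⟨hx, hy⟩
  exact hCV (mem_coverEntourage.2 ⟨_, hY, hx, hy⟩)

theorem residualBall_iota (a : K) (r : ℝ) (hr : 0 < r) :
    residualBall (iota (ProjTree.of (Tree.mk a r hr.le))) = {z | ‖z - a‖ ≤ r} := by
  have hsup : ∀ b : K, (Tree.mk a r hr.le).sup (Tree.ofField b) = max r ‖a - b‖ := fun b => by
    rw [Tree.ofField, Tree.mk, Tree.mk, Tree.sup_coe]
    simp [BallPair.sup, hr.le]
  have hinner : ∀ (b : K) (ρ : ℝ) (_ : ρ ∈ valueGroup K),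
      ProjLine.ofField '' {x | ‖x - b‖ < ρ} ∈ minimalFilter (iota (.of (Tree.mk a r hr.le))) ↔
        max r ‖a - b‖ < ρ := fun b ρ hρ => by
    rw [← hsup, ← OpenBall.of_mem_inner (hr := hρ), ← toSet_mem_minimalFilter_iota]
    rfl
  ext z
  constructor
  · intro hz
    change ‖z - a‖ ≤ r
    refine le_of_forall_gt fun t ht => ?_
    obtain ⟨ρ, hρ, h1, h2⟩ := exists_mem_valueGroup (K := K) hr ht
    refine lt_trans (b := ρ) ?_ h2
    exact hz a ρ (hr.trans h1) _ (Or.inl rfl) ((hinner a ρ hρ).2 (by simpa [hr] using And.intro h1 (hr.trans h1)))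
  · intro hz b ρ hρ B hB hmem
    have hzb : ‖z - b‖ ≤ max r ‖a - b‖ := by
      have := IsUltrametricDist.norm_add_le_max (z - a) (a - b)
      rw [sub_add_sub_cancel] at this
      exact this.trans (max_le_max_right _ hz)
    have hle : max r ‖a - b‖ ≤ ρ := by
      refine le_of_forall_gt fun t ht => ?_
      obtain ⟨ρ', hρ', h1, h2⟩ := exists_mem_valueGroup (K := K) hρ ht
      refine ((hinner b ρ' hρ').1 (mem_of_superset hmem (image_mono ?_))).trans h2
      rcases hB with rfl | rfl <;> intro x hx <;> simp only [mem_ofPred_eq] at hx ⊢ <;> linarith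
    rcases hB with rfl | rfl
    · refine lt_of_le_of_ne (hzb.trans hle) fun heq => ?_
      have hρ' : ρ ∈ valueGroup K := ⟨z - b, norm_pos_iff.1 (heq ▸ hρ), heq⟩
      exact absurd (hzb.trans_lt ((hinner b ρ hρ').1 hmem)) heq.not_lt
    · exact hzb.trans hle

end Identification

/-! ## Segments, convexity and the two topologies -/

/-- The geodesic segment between two points `a` and `b` of a metric space, as the set of the points
on a geodesic from `a` to `b`: the image of an isometric embedding of the interval `[0, dist a b]`
with end points `a` and `b` (which exists and is unique in a real tree). -/
def geodesicSegment {X : Type*} [MetricSpace X] (a b : X) : Set X :=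
  {c | ∃ γ : ℝ → X, γ 0 = a ∧ γ (dist a b) = b ∧
    (∀ s ∈ Icc 0 (dist a b), ∀ t ∈ Icc 0 (dist a b), dist (γ s) (γ t) = |s - t|) ∧
    c ∈ γ '' Icc 0 (dist a b)}

section Statement

variable (K : Type*) [NormedField K] [IsUltrametricDist K] [AdmissibleField K]

/-- The weak topology: the original topology of the Berkovich projective line. -/
abbrev weakTopology : TopologicalSpace (BerkLine K) := inferInstance

/-- The fine topology: the topology of the metric space `(𝒜'_K, Δ)`, transported by the
identification `ι`. -/
noncomputable abbrev fineTopology : TopologicalSpace (BerkLine K) :=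
  TopologicalSpace.coinduced (iota (K := K)) inferInstance

variable {K}

/-- The geodesic segments of the Berkovich projective line: the images by `ι` of the geodesic
segments `[S, T]` of the tree `(𝒜'_K, Δ)`. -/
def IsSegment (ℓ : Set (BerkLine K)) (p q : BerkLine K) : Prop :=
  ∃ S T : ProjTree K, iota S = p ∧ iota T = q ∧ ℓ = iota '' geodesicSegment S T

/-- A subset is convex if it contains the geodesic segments between its points. -/
def IsGeodesicallyConvex (V : Set (BerkLine K)) : Prop :=
  ∀ p ∈ V, ∀ q ∈ V, ∀ ℓ, IsSegment ℓ p q → ℓ ⊆ V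

/-- For the topology `τ`, there is a topological arc from `p` to `q` contained in `V`. -/
def JoinedByArc (τ : TopologicalSpace (BerkLine K)) (V : Set (BerkLine K)) (p q : BerkLine K) :
    Prop :=
  ∃ γ : Icc (0 : ℝ) 1 → BerkLine K, @IsEmbedding _ _ _ τ γ ∧ γ 0 = p ∧ γ 1 = q ∧ ∀ t, γ t ∈ V

end Statement

end BerkovichLine

/-! Root the projective tree at the Gauss point `[0, 1]`, and write h(S, T) for `chordalSup S T`.
This is the height at which the paths from S and T to the root meet; h(S, S) is the height of S
itself, and the root has height 1. The metric geometry rests on three facts: h(S, S) ≤ h(S, T) ≤ 1,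
the ultrametric inequality for h, and Δ(S, T) = h(S, T) - (h(S, S) + h(T, T)) / 2. The segment from
S to T therefore climbs from S to the join and descends to T, and each of its points lies above one
end and meets the other end at height h(S, T) (`eq_or_eq_of_dist_add_dist`, `exists_geodesic`).

The heart of the matter is that a weakly connected set is convex. Since balls with radius in the
dense value group are weakly open, h(·, [a, r]) is weakly continuous, and strict inequalities on
h(·, P) are weakly open for general P (`eventually_chordalSup_lt`, `eventually_lt_chordalSup`). If c
lies above S at height t on the way to T, then {h(·, S) < t} and {h(·, S) ≥ t} minus c are weakly
open and separate S from T (`mem_of_isPreconnected_of_above`). This argument covers the whole space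
because `iota` is bijective; surjectivity comes from finding, for every ultrafilter on the
projective line, a point of the tree whose balls it contains.

In the other direction, `iota` is continuous and segments are images of intervals, so convex sets
are connected for both topologies. Segments are compact for the fine topology and the weak one is
Hausdorff, hence the two agree there. Arcs are rescaled geodesics, and an intersection of convex
sets is convex. -/

namespace BerkovichLine

open Set Filter Topology UniformSpace

/-! ### Heights, joins and geodesics in the tree. -/

section Tree

variable {K : Type*} [NormedField K] [IsUltrametricDist K]

namespace Tree

theorem sup_nonneg (S T : Tree K) : 0 ≤ sup S T := (diam_nonneg S).trans (diam_le_sup S T)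

theorem diam_mk (a : K) (r : ℝ) (hr : 0 ≤ r) : diam (mk a r hr) = r := diam_coe _

theorem sup_ofField_ofField (a b : K) : sup (ofField a) (ofField b) = ‖a - b‖ := by
  rw [ofField, ofField, mk, mk, sup_coe]
  simp [BallPair.sup]

theorem sup_mk (S : Tree K) (a : K) (r : ℝ) (hr : 0 ≤ r) :
    sup S (mk a r hr) = max (sup S (ofField a)) r := by
  refine Completion.induction_on S (isClosed_eq (by fun_prop) (by fun_prop)) fun p => ?_
  rw [ofField, mk, mk, sup_coe, sup_coe]
  simp only [BallPair.sup, max_eq_left p.radius_nonneg]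
  exact max_right_comm _ _ _

/-- Above a point of the tree, at each larger diameter, there is a point `[a, r]`. -/
theorem exists_mk_above {S : Tree K} {r : ℝ} (h : diam S < r) :
    ∃ (a : K) (hr : 0 ≤ r), sup S (mk a r hr) = r := by
  have hopen : IsOpen {T : Tree K | sup S T < r} := isOpen_lt (by fun_prop) (by fun_prop)
  -- A point `[x, ρ]` close enough to `S` has its join with `S` below `r`; enlarging its radius to
  -- `r` gives a point above `S`.
  obtain ⟨p, hp⟩ := Completion.denseRange_coe.exists_mem_open hopen ⟨S, (sup_self S).trans_lt h⟩
  refine ⟨p.center, (diam_nonneg S).trans h.le, ?_⟩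
  rw [sup_mk, max_eq_right]
  have hp : sup S (mk p.center p.radius p.radius_nonneg) < r := hp
  rw [sup_mk] at hp
  exact (le_max_left _ _).trans hp.le

end Tree

namespace ProjTree

theorem max_one_abs_pos (S : Tree K) : 0 < max 1 S.abs := lt_max_of_lt_left one_pos

theorem dist_eq_chordalSup (S T : ProjTree K) :
    dist S T = chordalSup S T - chordalSup S S / 2 - chordalSup T T / 2 := rfl

theorem chordalSup_self_le_right (S T : ProjTree K) : chordalSup T T ≤ chordalSup S T := by
  rw [chordalSup_comm S T]
  exact chordalSup_self_le T S

theorem chordalSup_nonneg (S T : ProjTree K) : 0 ≤ chordalSup S T := by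
  cases S <;> cases T <;> simp only [chordalSup, le_refl]
  · positivity
  · positivity
  · exact div_nonneg (Tree.sup_nonneg _ _) (by positivity)

theorem chordalSup_le_one (S T : ProjTree K) : chordalSup S T ≤ 1 := by
  have h : ∀ A : Tree K, 1 / max 1 A.abs ≤ 1 := fun A => by
    rw [div_le_one (max_one_abs_pos A)]
    exact le_max_left _ _
  cases S with
  | infty =>
    cases T with
    | infty => exact zero_le_one
    | of T => exact h T
  | of S =>
    cases T with
    | infty => exact h S
    | of T =>
      have hS := max_one_abs_pos S
      have hT := max_one_abs_pos T
      rw [chordalSup, div_le_one (by positivity)]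
      have h : S.sup T ≤ max (max 1 S.abs) (max 1 T.abs) := by
        rw [Tree.max_one_abs, Tree.max_one_abs, Tree.sup_comm T]
        exact Tree.sup_triangle _ _ _
      refine h.trans (max_le ?_ ?_)
      · exact le_mul_of_one_le_right hS.le (le_max_left _ _)
      · exact le_mul_of_one_le_left hT.le (le_max_left _ _)

/-- The points `[0, R]` with `R ≥ 1` form the axis from the Gauss point to `∞`; there the height is
`R / R ^ 2 = 1 / R`. -/
theorem chordalSup_mk_zero_self {t : ℝ} (ht : 0 < t) (ht1 : t ≤ 1) :
    chordalSup (of (Tree.mk (0 : K) t⁻¹ (by positivity))) (of (Tree.mk 0 t⁻¹ (by positivity)))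
      = t := by
  have h1 : 1 ≤ t⁻¹ := (one_le_inv₀ ht).2 ht1
  have h0 : 0 ≤ t⁻¹ := by positivity
  simp only [chordalSup, Tree.sup_self, Tree.diam_mk, Tree.abs_mk, norm_zero, max_eq_right h0,
    max_eq_right h1]
  field_simp

/-- Above a point of the projective tree, at each larger height, there is a point `[a, r]`. -/
theorem exists_mk_above {S : ProjTree K} {t : ℝ} (h : chordalSup S S < t) (ht1 : t ≤ 1) :
    ∃ (a : K) (r : ℝ) (hr : 0 ≤ r),
      chordalSup (of (Tree.mk a r hr)) (of (Tree.mk a r hr)) = t ∧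
      chordalSup (of (Tree.mk a r hr)) S = t := by
  have ht : 0 < t := (chordalSup_nonneg S S).trans_lt h
  have h1 : 1 ≤ t⁻¹ := (one_le_inv₀ ht).2 ht1
  have h0 : 0 ≤ t⁻¹ := by positivity
  cases S with
  | infty =>
    refine ⟨0, t⁻¹, h0, chordalSup_mk_zero_self ht ht1, ?_⟩
    simp only [chordalSup, Tree.abs_mk, norm_zero, max_eq_right h0, max_eq_right h1]
    simp
  | of S =>
    have hm := max_one_abs_pos S
    have hm1 : 1 ≤ max 1 S.abs := le_max_left _ _
    set m := max 1 S.abs with hmdef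
    rcases le_or_gt t m⁻¹ with htm | htm
    -- As long as the diameter is at most `m`, climbing from `S` does not change `max 1 |·| = m`, so
    -- height `t` means diameter `t * m ^ 2`.
    · simp only [chordalSup, Tree.sup_self, ← hmdef] at h
      have hd : S.diam < t * (m * m) := by rwa [div_lt_iff₀ (by positivity)] at h
      obtain ⟨a, hr, ha⟩ := Tree.exists_mk_above hd
      have hrm : t * (m * m) ≤ m := by
        calc t * (m * m) ≤ m⁻¹ * (m * m) := by gcongr
          _ = m := by field_simp
      have habs : max 1 (Tree.mk a _ hr).abs = m := by
        rw [Tree.max_one_abs]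
        apply le_antisymm
        · refine (Tree.sup_triangle _ S _).trans (max_le ?_ ?_)
          · rw [Tree.sup_comm, ha]; exact hrm
          · rw [← Tree.max_one_abs]
        · have hle := Tree.diam_le_sup (Tree.mk a _ hr) (Tree.mk 0 1 zero_le_one)
          rw [Tree.diam_mk] at hle
          exact (Tree.max_one_abs S).le.trans
            ((Tree.sup_triangle S (Tree.mk a _ hr) _).trans (max_le (ha.le.trans hle) le_rfl))
      refine ⟨a, _, hr, ?_, ?_⟩
      · rw [chordalSup, habs, Tree.sup_self, Tree.diam_mk]
        field_simp
      · rw [chordalSup, habs, Tree.sup_comm, ha, ← hmdef]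
        field_simp
    -- Above height `1 / m` the path has joined the axis from `∞` to the Gauss point, and its point
    -- at height `t` is `[0, 1 / t]`.
    · have hlt : t⁻¹ < m := inv_lt_of_inv_lt₀ hm htm
      have hS : S.abs = m := by
        rw [hmdef, eq_comm, max_eq_right_iff]
        by_contra! hc
        rw [hmdef, max_eq_left hc.le] at hlt
        linarith
      refine ⟨0, t⁻¹, h0, chordalSup_mk_zero_self ht ht1, ?_⟩
      rw [chordalSup, Tree.sup_comm, Tree.sup_mk, ← Tree.abs, hS, max_eq_left hlt.le,
        max_eq_right hm1, Tree.abs_mk, norm_zero, max_eq_right h0, max_eq_right h1]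
      field_simp

theorem exists_above {S : ProjTree K} {t : ℝ} (h : chordalSup S S ≤ t) (ht1 : t ≤ 1) :
    ∃ P : ProjTree K, chordalSup P P = t ∧ chordalSup P S = t := by
  rcases h.eq_or_lt with h | h
  · exact ⟨S, h, h⟩
  · obtain ⟨a, r, hr, h1, h2⟩ := exists_mk_above h ht1
    exact ⟨_, h1, h2⟩

/-- Replacing `S` by a point above it at height `t` truncates every join from below at `t`. Both
inequalities are instances of the ultrametric one. -/
theorem chordalSup_eq_max {P S : ProjTree K} {t : ℝ} (h1 : chordalSup P P = t)
    (h2 : chordalSup P S = t) (U : ProjTree K) : chordalSup P U = max t (chordalSup S U) := by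
  apply le_antisymm
  · exact (chordalSup_triangle P S U).trans (by rw [h2])
  · refine max_le (h1 ▸ chordalSup_self_le P U) ?_
    refine (chordalSup_triangle S P U).trans (max_le ?_ le_rfl)
    rw [chordalSup_comm, h2, ← h1]
    exact chordalSup_self_le P U

theorem eq_of_chordalSup_eq {P Q : ProjTree K} (h1 : chordalSup P Q = chordalSup P P)
    (h2 : chordalSup P Q = chordalSup Q Q) : P = Q := by
  refine eq_of_chordalDist_eq_zero P Q ?_
  rw [chordalDist]
  linarith

/-- The points above `S` form a chain parametrised by height: by truncation, the join of two of them
at equal height has that same height. -/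
theorem eq_of_above {S P Q : ProjTree K} (h1 : chordalSup P S = chordalSup P P)
    (h2 : chordalSup Q S = chordalSup Q Q) (h : chordalSup P P = chordalSup Q Q) : P = Q := by
  have := chordalSup_eq_max rfl h1 Q
  rw [chordalSup_comm S, h2, h, max_self] at this
  exact eq_of_chordalSup_eq (this.trans h.symm) this

/-- Additivity of distances reads h(c, S) + h(c, T) = h(c, c) + h(S, T). The ultrametric inequality
bounds h(S, T) by one of the two terms on the left, while the other is at least h(c, c); both bounds
must be equalities. -/
theorem eq_or_eq_of_dist_add_dist {S T c : ProjTree K} (h : dist S c + dist c T = dist S T) :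
    (chordalSup c S = chordalSup c c ∧ chordalSup c T = chordalSup S T) ∨
      (chordalSup c T = chordalSup c c ∧ chordalSup c S = chordalSup S T) := by
  simp only [dist_eq_chordalSup] at h
  have h1 := chordalSup_self_le c S
  have h2 := chordalSup_self_le c T
  rw [chordalSup_comm S c] at h
  have h3 := chordalSup_triangle S c T
  rw [chordalSup_comm S c] at h3
  rcases le_max_iff.1 h3 with h3 | h3
  · right; constructor <;> linarith
  · left; constructor <;> linarith

theorem eq_of_dist_eq {S T c c' : ProjTree K} (h : dist S c + dist c T = dist S T)
    (h' : dist S c' + dist c' T = dist S T) (hd : dist S c = dist S c') : c = c' := by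
  have e1 := eq_or_eq_of_dist_add_dist h
  have e2 := eq_or_eq_of_dist_add_dist h'
  simp only [dist_eq_chordalSup] at hd
  rw [chordalSup_comm S c, chordalSup_comm S c'] at hd
  have l1 := chordalSup_self_le c T
  have l2 := chordalSup_self_le c' T
  have l3 := chordalSup_self_le c S
  have l4 := chordalSup_self_le c' S
  rcases e1 with ⟨a1, b1⟩ | ⟨a1, b1⟩ <;> rcases e2 with ⟨a2, b2⟩ | ⟨a2, b2⟩
  · exact eq_of_above a1 a2 (by linarith)
  -- With one point on each branch, equal distances to `S` give heights with sum `2 * chordalSup S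
  -- T`. Neither exceeds the join, so both points are at the join.
  · exact eq_of_above (S := S) a1 (by linarith) (by linarith)
  · exact eq_of_above (S := S) (by linarith) a2 (by linarith)
  · exact eq_of_above a1 a2 (by linarith)

theorem exists_geodesic (S T : ProjTree K) : ∃ γ : ℝ → ProjTree K, γ 0 = S ∧ γ (dist S T) = T ∧
    ∀ s ∈ Icc 0 (dist S T), ∀ t ∈ Icc 0 (dist S T), dist (γ s) (γ t) = |s - t| := by
  have hd := dist_eq_chordalSup S T
  set d := dist S T
  set h := chordalSup S T with hh
  set x := chordalSup S S with hx
  set y := chordalSup T T with hy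
  have h1 : h ≤ 1 := chordalSup_le_one S T
  have hxh : x ≤ h := chordalSup_self_le S T
  have hyh : y ≤ h := chordalSup_self_le_right S T
  have : Nonempty (ProjTree K) := ⟨S⟩
  -- A point at height `k` above `S`, below the join, is at distance `(k - x) / 2` from `S`; on the
  -- descending branch the distance is `h - (k + x) / 2`. Solving for `k` gives the two heights.
  have key : ∀ s ∈ Icc 0 d, ∃ P : ProjTree K,
      (2 * s + x ≤ h ∧ chordalSup P P = 2 * s + x ∧ chordalSup P S = 2 * s + x) ∨
      (h < 2 * s + x ∧ chordalSup P P = 2 * (h - s) - x ∧ chordalSup P T = 2 * (h - s) - x) := by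
    rintro s ⟨hs0, hsd⟩
    rcases le_or_gt (2 * s + x) h with hs | hs
    · obtain ⟨P, hP⟩ := exists_above (S := S) (t := 2 * s + x) (by linarith) (by linarith)
      exact ⟨P, Or.inl ⟨hs, hP⟩⟩
    · obtain ⟨P, hP⟩ := exists_above (S := T) (t := 2 * (h - s) - x) (by linarith) (by linarith)
      exact ⟨P, Or.inr ⟨hs, hP⟩⟩
  choose! γ hγ using key
  have hd0 : 0 ≤ d := dist_nonneg
  -- Points on opposite branches join at height `h`, by truncating first from `T` and then from `S`.
  have mixed : ∀ s t, (2 * s + x ≤ h ∧ chordalSup (γ s) (γ s) = 2 * s + x ∧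
      chordalSup (γ s) S = 2 * s + x) → (h < 2 * t + x ∧ chordalSup (γ t) (γ t) = 2 * (h - t) - x ∧
      chordalSup (γ t) T = 2 * (h - t) - x) → dist (γ s) (γ t) = t - s := by
    rintro s t ⟨a1, a2, a3⟩ ⟨b1, b2, b3⟩
    have e1 := chordalSup_eq_max a2 a3 (γ t)
    have e2 := chordalSup_eq_max b2 b3 S
    rw [chordalSup_comm T S, ← hh, max_eq_right (by linarith), chordalSup_comm] at e2
    rw [e2, max_eq_right (by linarith)] at e1
    rw [dist_eq_chordalSup, e1, a2, b2]
    ring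
  refine ⟨γ, ?_, ?_, ?_⟩
  · rcases hγ 0 ⟨le_rfl, hd0⟩ with ⟨-, a, b⟩ | ⟨a, -, -⟩
    · exact eq_of_chordalSup_eq (by rw [a, b]) (by rw [b, ← hx]; ring)
    · linarith
  · rcases hγ d ⟨hd0, le_rfl⟩ with ⟨c, a, b⟩ | ⟨-, a, b⟩
    · have e := chordalSup_eq_max a b T
      rw [← hh, max_eq_right c] at e
      exact eq_of_chordalSup_eq (by rw [e, a]; linarith) (by rw [e, ← hy]; linarith)
    · exact eq_of_chordalSup_eq (by rw [a, b]) (by rw [b, ← hy]; linarith)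
  · intro s hs t ht
    rcases hγ s hs with hs | hs <;> rcases hγ t ht with ht | ht
    · have e := chordalSup_eq_max hs.2.1 hs.2.2 (γ t)
      rw [chordalSup_comm S, ht.2.2] at e
      rw [dist_eq_chordalSup, e, hs.2.1, ht.2.1]
      rcases le_total s t with hst | hst
      · rw [max_eq_right (by linarith), abs_of_nonpos (by linarith)]; ring
      · rw [max_eq_left (by linarith), abs_of_nonneg (by linarith)]; ring
    · rw [mixed s t hs ht, abs_of_nonpos (by linarith [hs.1, ht.1])]; ring
    · rw [dist_comm, mixed t s ht hs, abs_of_nonneg (by linarith [hs.1, ht.1])]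
    · have e := chordalSup_eq_max hs.2.1 hs.2.2 (γ t)
      rw [chordalSup_comm T, ht.2.2] at e
      rw [dist_eq_chordalSup, e, hs.2.1, ht.2.1]
      rcases le_total s t with hst | hst
      · rw [max_eq_left (by linarith), abs_of_nonpos (by linarith)]; ring
      · rw [max_eq_right (by linarith), abs_of_nonneg (by linarith)]; ring

end ProjTree

theorem dist_add_dist_of_mem_geodesicSegment {X : Type*} [MetricSpace X] {a b c : X}
    (h : c ∈ geodesicSegment a b) : dist a c + dist c b = dist a b := by
  obtain ⟨γ, h0, h1, hγ, s, hs, rfl⟩ := h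
  have e1 := hγ 0 ⟨le_rfl, dist_nonneg⟩ s hs
  have e2 := hγ s hs (dist a b) ⟨dist_nonneg, le_rfl⟩
  rw [h0, abs_of_nonpos (by linarith [hs.1])] at e1
  rw [h1, abs_of_nonpos (by linarith [hs.2])] at e2
  linarith

/-- The definition of a segment collects the points of all geodesics. A point at given distance from
`S` is unique by `eq_of_dist_eq`, so a single geodesic already fills the segment. -/
theorem ProjTree.geodesicSegment_eq_image {S T : ProjTree K} {γ : ℝ → ProjTree K} (h0 : γ 0 = S)
    (h1 : γ (dist S T) = T)
    (hγ : ∀ s ∈ Icc 0 (dist S T), ∀ t ∈ Icc 0 (dist S T), dist (γ s) (γ t) = |s - t|) :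
    geodesicSegment S T = γ '' Icc 0 (dist S T) := by
  refine Subset.antisymm (fun c hc => ?_) fun c hc => ⟨γ, h0, h1, hγ, hc⟩
  have hc := dist_add_dist_of_mem_geodesicSegment hc
  have hmem : dist S c ∈ Icc 0 (dist S T) :=
    ⟨dist_nonneg, by linarith [dist_nonneg (x := c) (y := T)]⟩
  refine ⟨dist S c, hmem, ?_⟩
  have e1 := hγ 0 ⟨le_rfl, dist_nonneg⟩ _ hmem
  rw [h0, zero_sub, abs_neg, abs_of_nonneg hmem.1] at e1
  exact eq_of_dist_eq (dist_add_dist_of_mem_geodesicSegment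
    ⟨γ, h0, h1, hγ, mem_image_of_mem γ hmem⟩) hc e1

/-- `sup {S, a}` for `a ∈ K`, with the value `0` at `∞`. -/
noncomputable def ProjTree.supField : ProjTree K → K → ℝ
  | .infty, _ => 0
  | .of S, a => S.sup (Tree.ofField a)

/-- Against `[a, r]`, the height of the join depends only on `sup {S, a}` and `sup {S, 0}`, the
quantities that open balls control. -/
theorem ProjTree.chordalSup_mk {S : Tree K} {a : K} {r : ℝ} {hr : 0 ≤ r} :
    chordalSup (of S) (of (Tree.mk a r hr)) =
      max (supField (of S) a) r / (max 1 (supField (of S) 0) * max 1 (max ‖a‖ r)) := by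
  rw [chordalSup, Tree.sup_mk, Tree.abs_mk]
  rfl

theorem continuousOn_of_dist_eq {S T : ProjTree K} {γ : ℝ → ProjTree K}
    (hγ : ∀ s ∈ Icc 0 (dist S T), ∀ t ∈ Icc 0 (dist S T), dist (γ s) (γ t) = |s - t|) :
    ContinuousOn γ (Icc 0 (dist S T)) := by
  refine (LipschitzOnWith.of_dist_le_mul (K := 1) fun s hs t ht => ?_).continuousOn
  rw [hγ s hs t ht, NNReal.coe_one, one_mul, Real.dist_eq]

theorem isCompact_geodesicSegment (S T : ProjTree K) : IsCompact (geodesicSegment S T) := by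
  obtain ⟨γ, h0, h1, hγ⟩ := ProjTree.exists_geodesic S T
  rw [ProjTree.geodesicSegment_eq_image h0 h1 hγ]
  exact isCompact_Icc.image_of_continuousOn (continuousOn_of_dist_eq hγ)

theorem isPreconnected_geodesicSegment (S T : ProjTree K) :
    IsPreconnected (geodesicSegment S T) := by
  obtain ⟨γ, h0, h1, hγ⟩ := ProjTree.exists_geodesic S T
  rw [ProjTree.geodesicSegment_eq_image h0 h1 hγ]
  exact isPreconnected_Icc.image γ (continuousOn_of_dist_eq hγ)

theorem left_mem_geodesicSegment (S T : ProjTree K) : S ∈ geodesicSegment S T := by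
  obtain ⟨γ, h0, h1, hγ⟩ := ProjTree.exists_geodesic S T
  exact ⟨γ, h0, h1, hγ, 0, ⟨le_rfl, dist_nonneg⟩, h0⟩

theorem right_mem_geodesicSegment (S T : ProjTree K) : T ∈ geodesicSegment S T := by
  obtain ⟨γ, h0, h1, hγ⟩ := ProjTree.exists_geodesic S T
  exact ⟨γ, h0, h1, hγ, _, ⟨dist_nonneg, le_rfl⟩, h1⟩

end Tree

/-! ### Weak continuity of joins. -/

section WeakTopology

variable {K : Type*} [NormedField K] [IsUltrametricDist K] [AdmissibleField K]

/-- A neighbourhood of `p` is also one of every point near `p`, so its trace on the projective line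
witnesses membership for all these points. -/
theorem isOpen_setOf_mem_minimalFilter (U : Set (ProjLine K)) :
    IsOpen {p : BerkLine K | U ∈ minimalFilter p} := by
  rw [isOpen_iff_mem_nhds]
  rintro p ⟨W, hW, hWU⟩
  filter_upwards [eventually_mem_nhds_iff.2 hW] with q hq
  exact ⟨W, hq, hWU⟩

/-- The open balls of the tree are open for the weak topology. -/
theorem treeSet_mem_comap_nhds {S : ProjTree K} {D : OpenBall K} (h : S ∈ D.treeSet) :
    D.treeSet ∈ Filter.comap iota (𝓝 (iota S)) := by
  refine ⟨_, (isOpen_setOf_mem_minimalFilter D.toSet).mem_nhds (toSet_mem_minimalFilter_iota.2 h),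
    fun T hT => toSet_mem_minimalFilter_iota.1 hT⟩

theorem eventually_ne_infty {S : Tree K} :
    ∀ᶠ T in Filter.comap iota (𝓝 (iota (.of S))), T ≠ (.infty : ProjTree K) := by
  obtain ⟨ρ, hρ, h1, -⟩ := exists_mem_valueGroup (K := K)
    (lt_of_lt_of_le one_pos (le_max_left 1 S.abs)) (lt_add_one _)
  have h : ProjTree.of S ∈ (⟨0, ρ, hρ, false⟩ : OpenBall K).treeSet :=
    OpenBall.of_mem_inner.2 ((le_max_right _ _).trans_lt h1)
  filter_upwards [treeSet_mem_comap_nhds h] with T hT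
  rintro rfl
  simp at hT

/-- Sublevel and superlevel sets at radii of the value group are open balls of the tree, apart from
`∞`, which is avoided near `S`. Density of the value group supplies enough radii. -/
theorem tendsto_supField (S : Tree K) (a : K) :
    Tendsto (fun T : ProjTree K => T.supField a) (Filter.comap iota (𝓝 (iota (.of S))))
      (𝓝 (S.sup (Tree.ofField a))) := by
  have hnn : ∀ T : Tree K, 0 ≤ T.sup (Tree.ofField a) := fun T => Tree.sup_nonneg _ _
  refine tendsto_order.2 ⟨fun x hx => ?_, fun x hx => ?_⟩
  -- At value `0` the lower bound is automatic, including at `∞`, where `supField` is `0`.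
  · rcases (hnn S).eq_or_lt with h0 | h0
    · refine Eventually.of_forall fun T => ?_
      rw [← h0] at hx
      cases T with
      | infty => exact hx
      | of T => exact hx.trans_le (hnn T)
    -- `x` may be negative; the maximum with half the value keeps the lower end of the interval
    -- positive.
    obtain ⟨ρ, hρ, h1, h2⟩ := exists_mem_valueGroup (K := K)
      (lt_max_of_lt_right (half_pos h0)) (max_lt hx (half_lt_self h0))
    have h : ProjTree.of S ∈ (⟨a, ρ, hρ, true⟩ : OpenBall K).treeSet := OpenBall.of_mem_outer.2 h2
    filter_upwards [treeSet_mem_comap_nhds h, eventually_ne_infty] with T hT hT'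
    cases T with
    | infty => exact absurd rfl hT'
    | of T => exact (le_max_left _ _).trans_lt (h1.trans (OpenBall.of_mem_outer.1 hT))
  · obtain ⟨y, hy1, hy2⟩ := exists_between hx
    obtain ⟨ρ, hρ, h1, h2⟩ := exists_mem_valueGroup (K := K) ((hnn S).trans_lt hy1) hy2
    have h : ProjTree.of S ∈ (⟨a, ρ, hρ, false⟩ : OpenBall K).treeSet :=
      OpenBall.of_mem_inner.2 (hy1.trans h1)
    filter_upwards [treeSet_mem_comap_nhds h] with T hT
    cases T with
    | infty => simp at hT
    | of T => exact (OpenBall.of_mem_inner.1 hT).trans h2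

/-- The map `S ↦ sup {S, [a, r]}` is continuous for the weak topology. -/
theorem tendsto_chordalSup_mk (S : ProjTree K) (a : K) (r : ℝ) (hr : 0 ≤ r) :
    Tendsto (fun T => ProjTree.chordalSup T (.of (Tree.mk a r hr)))
      (Filter.comap iota (𝓝 (iota S))) (𝓝 (S.chordalSup (.of (Tree.mk a r hr)))) := by
  have hm : 0 < max 1 (max ‖a‖ r) := lt_max_of_lt_left one_pos
  cases S with
  | infty =>
    -- Once `|T|` exceeds `1`, `‖a‖` and `r`, `sup {T, a} = |T|` and the quotient equals its value
    -- at `∞`: the function is constant near `∞`.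
    obtain ⟨ρ, hρ, h1, -⟩ := exists_mem_valueGroup (K := K) hm (lt_add_one _)
    have h : ProjTree.infty ∈ (⟨0, ρ, hρ, true⟩ : OpenBall K).treeSet :=
      OpenBall.tree_infty_mem_outer
    refine tendsto_const_nhds.congr' ?_
    filter_upwards [treeSet_mem_comap_nhds h] with T hT
    cases T with
    | infty => rfl
    | of T =>
      have hT : ρ < T.abs := OpenBall.of_mem_outer.1 hT
      obtain ⟨h2, h3, h4⟩ : 1 < T.abs ∧ ‖a‖ < T.abs ∧ r < T.abs := by
        have := h1.trans hT
        rwa [max_lt_iff, max_lt_iff] at this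
      have hsup : T.sup (Tree.ofField a) = T.abs := by
        apply le_antisymm
        · refine (Tree.sup_triangle T (Tree.ofField 0) _).trans ?_
          rw [Tree.sup_ofField_ofField, zero_sub, norm_neg]
          exact max_le le_rfl h3.le
        · have := Tree.sup_triangle T (Tree.ofField a) (Tree.ofField 0)
          rw [Tree.sup_ofField_ofField, sub_zero] at this
          exact (le_max_iff.1 this).resolve_right (not_le.2 h3)
      simp only [ProjTree.chordalSup, Tree.sup_mk, Tree.abs_mk, hsup, max_eq_left h4.le,
        max_eq_right h2.le]
      have : T.abs ≠ 0 := by linarith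
      field_simp
  | of S =>
    have h1 := tendsto_supField S a
    have h0 := tendsto_supField S 0
    rw [ProjTree.chordalSup_mk]
    refine Tendsto.congr' (f₁ := fun T => max (T.supField a) r /
      (max 1 (T.supField 0) * max 1 (max ‖a‖ r))) ?_ ?_
    · filter_upwards [eventually_ne_infty] with T hT
      cases T with
      | infty => exact absurd rfl hT
      | of T => exact ProjTree.chordalSup_mk.symm
    · refine (h1.max tendsto_const_nhds).div
        ((tendsto_const_nhds.max h0).mul tendsto_const_nhds) ?_
      have : 0 < max 1 (S.sup (Tree.ofField 0)) := lt_max_of_lt_left one_pos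
      exact (mul_pos this hm).ne'

/-- `P` need not be of the form `[a, r]`, so it is replaced by such a point above it at a height `u`
between `chordalSup S P` and `t`. Truncating at `u < t` does not affect the condition of being less
than `t`. -/
theorem eventually_chordalSup_lt {S P : ProjTree K} {t : ℝ} (h : S.chordalSup P < t) :
    ∀ᶠ T in Filter.comap iota (𝓝 (iota S)), T.chordalSup P < t := by
  rcases lt_or_ge 1 t with ht1 | ht1
  · exact Eventually.of_forall fun T => (T.chordalSup_le_one P).trans_lt ht1
  obtain ⟨u, hu1, hu2⟩ := exists_between h
  obtain ⟨a, r, hr, e1, e2⟩ := ProjTree.exists_mk_above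
    ((S.chordalSup_self_le_right P).trans_lt hu1) (hu2.le.trans ht1)
  have e : ∀ U : ProjTree K, U.chordalSup (.of (Tree.mk a r hr)) = max u (U.chordalSup P) :=
    fun U => by
      rw [ProjTree.chordalSup_comm U, ProjTree.chordalSup_comm U,
        ProjTree.chordalSup_eq_max e1 e2]
  have := (tendsto_chordalSup_mk S a r hr).eventually_lt_const (u := t) (by
    rw [e]; exact max_lt hu2 h)
  filter_upwards [this] with T hT
  rw [e] at hT
  exact (le_max_right _ _).trans_lt hT

/-- Here `P` is replaced by a point above it at height exactly `t`, which exists by `hP`; truncation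
at `t` does not affect being greater than `t`. -/
theorem eventually_lt_chordalSup {S P : ProjTree K} {t : ℝ} (hP : P.chordalSup P < t)
    (h : t < S.chordalSup P) :
    ∀ᶠ T in Filter.comap iota (𝓝 (iota S)), t < T.chordalSup P := by
  obtain ⟨a, r, hr, e1, e2⟩ := ProjTree.exists_mk_above hP (h.le.trans (S.chordalSup_le_one P))
  have e : ∀ U : ProjTree K, U.chordalSup (.of (Tree.mk a r hr)) = max t (U.chordalSup P) :=
    fun U => by
      rw [ProjTree.chordalSup_comm U, ProjTree.chordalSup_comm U,
        ProjTree.chordalSup_eq_max e1 e2]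
  have := (tendsto_chordalSup_mk S a r hr).eventually_const_lt (u := t) (by
    rw [e]; exact lt_max_of_lt_right h)
  filter_upwards [this] with T hT
  rw [e] at hT
  exact (lt_max_iff.1 hT).resolve_left (lt_irrefl _)

end WeakTopology

/-! ### Bijectivity of the identification. -/

section Bijective

variable {K : Type*} [NormedField K] [IsUltrametricDist K]

/-- By `sup_mk` and density the hypothesis extends from `K` to the whole tree. Evaluating at `S` and
at `T` gives `diam S = sup S T = diam T`, hence distance zero. -/
theorem Tree.eq_of_sup_ofField_eq {S T : Tree K}
    (h : ∀ a, S.sup (Tree.ofField a) = T.sup (Tree.ofField a)) : S = T := by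
  have h' : ∀ U : Tree K, S.sup U = T.sup U := fun U => by
    refine Completion.induction_on U (isClosed_eq (by fun_prop) (by fun_prop)) fun p => ?_
    change S.sup (Tree.mk p.center p.radius p.radius_nonneg) = T.sup (Tree.mk _ _ _)
    rw [Tree.sup_mk, Tree.sup_mk, h]
  have e1 := h' S
  have e2 := h' T
  rw [Tree.sup_self] at e1 e2
  rw [← dist_eq_zero]
  have : S.sup T = dist S T + (S.diam + T.diam) / 2 := rfl
  rw [Tree.sup_comm] at e1
  linarith

/-- A function on `K` which behaves like `a ↦ sup {S, a}` comes from a point of the tree. -/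
theorem Tree.exists_sup_ofField_eq {s : K → ℝ} (h0 : ∀ a, 0 ≤ s a)
    (h1 : ∀ a b, s a ≤ max (s b) ‖a - b‖) (h2 : ∀ a b, ‖a - b‖ ≤ max (s a) (s b)) :
    ∃ S : Tree K, ∀ a, S.sup (Tree.ofField a) = s a := by
  have hbdd : BddBelow (range s) := ⟨0, by rintro _ ⟨a, rfl⟩; exact h0 a⟩
  -- The point sought is the limit of `[a n, s (a n)]` with `s (a n)` tending to the infimum of `s`.
  -- By `h2` these points are nested, so their distances are controlled by the differences of the
  -- radii.
  obtain ⟨u, -, hu, hmem⟩ := exists_seq_tendsto_sInf (range_nonempty s) hbdd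
  choose a ha using hmem
  let p : ℕ → BallPair K := fun n => ⟨a n, s (a n), h0 _⟩
  have hdist : ∀ m n, dist (p m) (p n) ≤ dist (u m) (u n) := fun m n => by
    have h3 : (p m).sup (p n) ≤ max (s (a m)) (s (a n)) := max_le le_rfl (h2 _ _)
    rw [BallPair.dist_def, Real.dist_eq, ← ha m, ← ha n]
    change _ - (s (a m) + s (a n)) / 2 ≤ _
    rcases le_total (s (a m)) (s (a n)) with h | h
    · rw [max_eq_right h] at h3
      rw [abs_of_nonpos (by linarith)]
      linarith
    · rw [max_eq_left h] at h3
      rw [abs_of_nonneg (by linarith)]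
      linarith
  have hc : CauchySeq fun n => (p n : Tree K) := by
    refine Metric.cauchySeq_iff.2 fun ε hε => ?_
    obtain ⟨N, hN⟩ := Metric.cauchySeq_iff.1 hu.cauchySeq ε hε
    refine ⟨N, fun m hm n hn => ?_⟩
    rw [Completion.dist_eq]
    exact (hdist m n).trans_lt (hN m hm n hn)
  obtain ⟨S, hS⟩ := cauchySeq_tendsto_of_complete hc
  refine ⟨S, fun b => ?_⟩
  have hlim : Tendsto (fun n => Tree.sup (p n : Tree K) (Tree.ofField b)) atTop
      (𝓝 (Tree.sup S (Tree.ofField b))) :=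
    ((Tree.continuous_sup continuous_id continuous_const).tendsto S).comp hS
  have he : ∀ n, Tree.sup (p n : Tree K) (Tree.ofField b) = max (s (a n)) ‖a n - b‖ := fun n => by
    rw [Tree.ofField, Tree.mk, Tree.sup_coe]
    simp [BallPair.sup, p, h0]
  have hlim' : Tendsto (fun n => max (u n) (s b)) atTop (𝓝 (max (sInf (range s)) (s b))) :=
    hu.max tendsto_const_nhds
  rw [max_eq_right (csInf_le hbdd (mem_range_self b))] at hlim'
  -- The joins with `b` are squeezed between `s b`, by `h1`, and `max (u n) (s b)`, by `h2`.
  refine tendsto_nhds_unique hlim (tendsto_of_tendsto_of_tendsto_of_le_of_le tendsto_const_nhds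
    hlim' (fun n => ?_) fun n => ?_)
  · change s b ≤ _
    rw [he, norm_sub_rev]
    exact h1 b (a n)
  · change _ ≤ max (u n) (s b)
    rw [he, ← ha]
    exact max_le (le_max_left _ _) (h2 _ _)

/-- If `G` contains no bounded closed ball, the point is `∞`. Otherwise let `s a` be the infimum of
the radii of the closed balls about `a` in `G`: the ultrametric inequality makes `s` a function of
the form `sup {S, ·}`. Maximality of `G` puts the complements of the remaining balls in `G`. -/
theorem exists_ballFilter_ge (G : Ultrafilter (ProjLine K)) :
    ∃ S : ProjTree K, (G : Filter (ProjLine K)) ≤ ballFilter S := by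
  let B : K → ℝ → Set (ProjLine K) := fun a r => ProjLine.ofField '' {z | ‖z - a‖ ≤ r}
  have hmono : ∀ a r r', r ≤ r' → B a r ∈ G → B a r' ∈ G := fun a r r' hr h =>
    mem_of_superset h (image_mono fun z hz => le_trans hz hr)
  have hle : ∀ S : ProjTree K, (∀ D : OpenBall K, S ∈ D.treeSet → D.toSet ∈ G) →
      (G : Filter (ProjLine K)) ≤ ballFilter S := fun S h => by
    refine Filter.le_generate_iff.2 ?_
    rintro _ ⟨D, hD, rfl⟩
    exact h D hD
  by_cases hG : ∃ a r, B a r ∈ G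
  · obtain ⟨b, ρ, hb⟩ := hG
    have hne : ∀ a, {r | B a r ∈ G}.Nonempty := fun a => by
      refine ⟨max ρ ‖b - a‖, mem_of_superset hb (image_mono fun z (hz : ‖z - b‖ ≤ ρ) => ?_)⟩
      have := IsUltrametricDist.norm_add_le_max (z - b) (b - a)
      rw [sub_add_sub_cancel] at this
      exact this.trans (max_le_max_right _ hz)
    have hnn : ∀ a, ∀ r ∈ {r | B a r ∈ G}, 0 ≤ r := fun a r hr => by
      obtain ⟨_, z, hz, rfl⟩ := G.nonempty_of_mem hr
      exact (norm_nonneg _).trans hz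
    have hbdd : ∀ a, BddBelow {r | B a r ∈ G} := fun a => ⟨0, hnn a⟩
    let s : K → ℝ := fun a => sInf {r | B a r ∈ G}
    have hs1 : ∀ a r, s a < r → B a r ∈ G := fun a r h => by
      obtain ⟨r', hr', h⟩ := exists_lt_of_csInf_lt (hne a) h
      exact hmono a r' r h.le hr'
    obtain ⟨S, hS⟩ := Tree.exists_sup_ofField_eq (s := s) (fun a => le_csInf (hne a) (hnn a))
      (fun a c => by
        refine le_of_forall_gt_imp_ge_of_dense fun r hr => csInf_le (hbdd a) ?_
        rw [max_lt_iff] at hr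
        refine mem_of_superset (hs1 c r hr.1) (image_mono fun z (hz : ‖z - c‖ ≤ r) => ?_)
        have := norm_sub_le_max' (z - c) (a - c)
        rw [sub_sub_sub_cancel_right] at this
        exact this.trans (max_le hz hr.2.le))
      (fun a c => by
        refine le_of_forall_gt_imp_ge_of_dense fun r hr => ?_
        rw [max_lt_iff] at hr
        obtain ⟨_, ⟨z, hz, rfl⟩, z', hz', hzz⟩ :=
          G.nonempty_of_mem (inter_mem (hs1 a r hr.1) (hs1 c r hr.2))
        obtain rfl := ProjLine.ofField_injective hzz
        have := norm_sub_le_max' (z' - c) (z' - a)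
        rw [sub_sub_sub_cancel_left] at this
        exact this.trans (max_le hz' hz))
    refine ⟨.of S, hle _ ?_⟩
    rintro ⟨a, r, hr, o⟩ hD
    cases o
    · rw [OpenBall.of_mem_inner, hS] at hD
      obtain ⟨r', h1, h2⟩ := exists_between hD
      exact mem_of_superset (hs1 a r' h1) (image_mono fun z hz => lt_of_le_of_lt hz h2)
    · rw [OpenBall.of_mem_outer, hS] at hD
      exact Ultrafilter.compl_mem_iff_notMem.2 fun h => hD.not_ge (csInf_le (hbdd a) h)
  · push Not at hG
    refine ⟨.infty, hle _ ?_⟩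
    rintro ⟨a, r, hr, o⟩ hD
    cases o
    · simp at hD
    · exact Ultrafilter.compl_mem_iff_notMem.2 (hG a r)

variable [AdmissibleField K]

/-- The minimal filter of `iota S` remembers which balls of the tree contain `S`. The bounded ones
tell `∞` apart and, by density of the value group, determine `sup {S, a}` for each `a`. -/
theorem iota_injective : Function.Injective (iota (K := K)) := by
  intro S T hST
  have hD : ∀ D : OpenBall K, S ∈ D.treeSet ↔ T ∈ D.treeSet := fun D => by
    rw [← toSet_mem_minimalFilter_iota, hST, toSet_mem_minimalFilter_iota]
  have hinf : ∀ S : Tree K, ¬ ∀ D : OpenBall K, ProjTree.of S ∈ D.treeSet ↔ .infty ∈ D.treeSet := by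
    intro S h
    obtain ⟨ρ, hρ, h1, -⟩ := exists_mem_valueGroup (K := K)
      (lt_of_lt_of_le one_pos (le_max_left 1 S.abs)) (lt_add_one _)
    exact OpenBall.tree_infty_notMem_inner
      ((h ⟨0, ρ, hρ, false⟩).1 (OpenBall.of_mem_inner.2 ((le_max_right _ _).trans_lt h1)))
  have hle : ∀ (S T : Tree K) (a : K), (∀ D : OpenBall K, ProjTree.of S ∈ D.treeSet ↔
      .of T ∈ D.treeSet) → S.sup (Tree.ofField a) ≤ T.sup (Tree.ofField a) := by
    intro S T a h
    by_contra! hlt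
    obtain ⟨y, hy1, hy2⟩ := exists_between hlt
    obtain ⟨ρ, hρ, h1, h2⟩ := exists_mem_valueGroup (K := K)
      ((Tree.sup_nonneg _ _).trans_lt hy1) hy2
    have := OpenBall.of_mem_inner.1
      ((h ⟨a, ρ, hρ, false⟩).2 (OpenBall.of_mem_inner.2 (hy1.trans h1)))
    exact absurd this (not_lt.2 h2.le)
  cases S with
  | infty =>
    cases T with
    | infty => rfl
    | of T => exact absurd (fun D => (hD D).symm) (hinf T)
  | of S =>
    cases T with
    | infty => exact absurd hD (hinf S)
    | of T =>
      congr 1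
      exact Tree.eq_of_sup_ofField_eq fun a =>
        le_antisymm (hle S T a hD) (hle T S a fun D => (hD D).symm)

/-- An ultrafilter on the projective line converging to `x` also converges to some `iota S`, because
it refines the ball filter of `S`; limits are unique in the Hausdorff completion. -/
theorem iota_surjective : Function.Surjective (iota (K := K)) := by
  intro x
  have : (Filter.comap ((↑) : ProjLine K → BerkLine K) (𝓝 x)).NeBot :=
    (Completion.isDenseInducing_coe (α := ProjLine K)).comap_nhds_neBot x
  let G := Ultrafilter.of (Filter.comap ((↑) : ProjLine K → BerkLine K) (𝓝 x))
  obtain ⟨S, hS⟩ := exists_ballFilter_ge G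
  refine ⟨S, tendsto_nhds_unique (l := (G : Filter (ProjLine K)))
    (f := ((↑) : ProjLine K → BerkLine K)) ?_ ?_⟩
  · exact Filter.tendsto_iff_comap.2 (hS.trans (ballFilter_le_minimalFilter S))
  · exact Filter.tendsto_iff_comap.2 (Ultrafilter.of_le _)

/-- By surjectivity of `iota`, weak openness can be tested on the tree with the pulled-back
neighbourhood filters. -/
theorem isOpen_image_iota {A : Set (ProjTree K)}
    (hA : ∀ S ∈ A, A ∈ Filter.comap iota (𝓝 (iota S))) : IsOpen (iota '' A) := by
  rw [isOpen_iff_mem_nhds]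
  rintro _ ⟨S, hS, rfl⟩
  obtain ⟨U, hU, hUA⟩ := hA S hS
  refine mem_of_superset hU fun x hx => ?_
  obtain ⟨T, rfl⟩ := iota_surjective x
  exact ⟨T, hUA hx, rfl⟩

end Bijective

/-! ### Connectedness, convexity and arcs. -/

section Connected

variable {K : Type*} [NormedField K] [IsUltrametricDist K] [AdmissibleField K]

/-- A point `c` strictly above `S` separates, for the weak topology, the branch of `S` below `c`
from the other points. -/
theorem mem_of_isPreconnected_of_above {V : Set (BerkLine K)} (hV : IsPreconnected V)
    {S T c : ProjTree K} (hS : iota S ∈ V) (hT : iota T ∈ V)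
    (h1 : c.chordalSup S = c.chordalSup c) (h2 : c.chordalSup T = S.chordalSup T) :
    iota c ∈ V := by
  by_contra hc
  set t := c.chordalSup c with ht
  have hne : ∀ P, iota P ∈ V → P ≠ c := by
    rintro P hP rfl
    exact hc hP
  -- A point below `c` and different from it has height strictly less than `t`.
  have hlt : ∀ P, P ≠ c → c.chordalSup P = t → P.chordalSup P < t := fun P hP h => by
    have := c.chordalSup_self_le_right P
    rw [h] at this
    refine lt_of_le_of_ne this fun he => hP ?_
    refine ProjTree.eq_of_chordalSup_eq ?_ ?_ <;> rw [ProjTree.chordalSup_comm, h]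
    exact he.symm
  have hStS := hlt S (hne S hS) h1
  let A : Set (ProjTree K) := {P | P.chordalSup S < t}
  let B : Set (ProjTree K) := {P | t ≤ P.chordalSup S ∧ P ≠ c}
  have hA : IsOpen (iota '' A) := isOpen_image_iota fun P hP => eventually_chordalSup_lt hP
  have hB : IsOpen (iota '' B) := isOpen_image_iota fun P hP => by
    -- If the join of `P` and `S` is at height `t`, then `P` hangs below `c` on a branch other than
    -- that of `S`. The open set of points joining `P` below `t` stays on that branch and misses
    -- `c`. If the join is higher, the strict inequality is open and excludes `c`, which joins `S`
    -- at `t`.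
    rcases hP.1.eq_or_lt with h | h
    · have hcP : c.chordalSup P = t := by
        rw [ProjTree.chordalSup_eq_max rfl h1, ProjTree.chordalSup_comm S, ← h, max_self]
      filter_upwards [eventually_chordalSup_lt (hlt P hP.2 hcP)] with Q hQ
      refine ⟨?_, ?_⟩
      · by_contra! hQS
        have := P.chordalSup_triangle Q S
        rw [ProjTree.chordalSup_comm P Q, ← h] at this
        exact absurd this (not_le.2 (max_lt hQ hQS))
      · rintro rfl
        exact hQ.ne hcP
    · filter_upwards [eventually_lt_chordalSup hStS h] with Q hQ
      refine ⟨hQ.le, ?_⟩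
      rintro rfl
      exact hQ.ne' h1
  have hcov : V ⊆ iota '' A ∪ iota '' B := fun x hx => by
    obtain ⟨P, rfl⟩ := iota_surjective x
    rcases lt_or_ge (P.chordalSup S) t with h | h
    · exact Or.inl ⟨P, h, rfl⟩
    · exact Or.inr ⟨P, ⟨h, hne P hx⟩, rfl⟩
  have hdisj : V ∩ (iota '' A ∩ iota '' B) = ∅ := by
    rw [← image_inter iota_injective, eq_empty_iff_forall_notMem]
    rintro _ ⟨-, P, ⟨hPA, hPB⟩, rfl⟩
    exact absurd hPA (not_lt.2 hPB.1)
  -- `T` cannot be in `A`, since its join with `S` is its join with `c`, at height at least `t`; `S`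
  -- cannot be in `B`, its own height being less than `t`.
  rcases isPreconnected_iff_subset_of_disjoint.1 hV _ _ hA hB hcov hdisj with h | h
  · obtain ⟨P, hP, hPT⟩ := h hT
    obtain rfl := iota_injective hPT
    have hP : P.chordalSup S < t := hP
    rw [ProjTree.chordalSup_comm, ← h2] at hP
    exact absurd hP (not_lt.2 (c.chordalSup_self_le P))
  · obtain ⟨P, hP, hPS⟩ := h hS
    obtain rfl := iota_injective hPS
    exact absurd hStS (not_lt.2 hP.1)

theorem isGeodesicallyConvex_of_isPreconnected {V : Set (BerkLine K)} (hV : IsPreconnected V) :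
    IsGeodesicallyConvex V := by
  rintro _ hp _ hq _ ⟨S, T, rfl, rfl, rfl⟩ _ ⟨c, hc, rfl⟩
  rcases ProjTree.eq_or_eq_of_dist_add_dist (dist_add_dist_of_mem_geodesicSegment hc) with h | h
  · exact mem_of_isPreconnected_of_above hV hp hq h.1 h.2
  · rw [ProjTree.chordalSup_comm S T] at h
    exact mem_of_isPreconnected_of_above hV hq hp h.1 h.2

theorem fineTopology_le_weakTopology : fineTopology K ≤ weakTopology K :=
  continuous_iff_coinduced_le.1 continuous_iota

theorem t2Space_fineTopology : @T2Space _ (fineTopology K) :=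
  t2Space_antitone fineTopology_le_weakTopology inferInstance

/-- Convex sets are connected for every topology that makes `ι` continuous. -/
theorem IsGeodesicallyConvex.isPreconnected {τ : TopologicalSpace (BerkLine K)}
    (hτ : Continuous[inferInstance, τ] (iota (K := K))) {V : Set (BerkLine K)}
    (hV : IsGeodesicallyConvex V) : @IsPreconnected _ τ V := by
  refine @isPreconnected_of_forall_pair _ τ V fun p hp q hq => ?_
  obtain ⟨S, rfl⟩ := iota_surjective p
  obtain ⟨T, rfl⟩ := iota_surjective q
  exact ⟨_, hV _ hp _ hq _ ⟨S, T, rfl, rfl, rfl⟩, mem_image_of_mem _ (left_mem_geodesicSegment S T),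
    mem_image_of_mem _ (right_mem_geodesicSegment S T),
    @IsPreconnected.image _ _ _ τ _ (isPreconnected_geodesicSegment S T) _
      (@Continuous.continuousOn _ _ _ τ _ _ hτ)⟩

theorem isPreconnected_weakTopology_of_fineTopology {V : Set (BerkLine K)}
    (hV : @IsPreconnected _ (fineTopology K) V) : IsPreconnected V := by
  have := @IsPreconnected.image _ _ (fineTopology K) _ V hV id
    (@Continuous.continuousOn _ _ (fineTopology K) _ _ _
      (continuous_id_iff_le.2 fineTopology_le_weakTopology))
  rwa [image_id] at this

theorem tfae_convex_isPreconnected (V : Set (BerkLine K)) :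
    List.TFAE [IsGeodesicallyConvex V, @IsPreconnected _ (fineTopology K) V,
      @IsPreconnected _ (weakTopology K) V] := by
  tfae_have 1 → 2 := fun h => h.isPreconnected continuous_coinduced_rng
  tfae_have 2 → 3 := isPreconnected_weakTopology_of_fineTopology
  tfae_have 3 → 1 := isGeodesicallyConvex_of_isPreconnected
  tfae_finish

/-- A segment is compact for the fine topology, and the coarser weak topology is Hausdorff; a
continuous bijection from a compact space to a Hausdorff one is a homeomorphism. -/
theorem induced_weakTopology_eq_induced_fineTopology {ℓ : Set (BerkLine K)} {p q : BerkLine K}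
    (hℓ : IsSegment ℓ p q) :
    TopologicalSpace.induced (Subtype.val : ℓ → BerkLine K) (weakTopology K) =
      TopologicalSpace.induced (Subtype.val : ℓ → BerkLine K) (fineTopology K) := by
  obtain ⟨S, T, -, -, rfl⟩ := hℓ
  refine le_antisymm ?_ (induced_mono fineTopology_le_weakTopology)
  have hc : @IsCompact _ (fineTopology K) (iota '' geodesicSegment S T) :=
    @IsCompact.image _ _ _ (fineTopology K) _ _ (isCompact_geodesicSegment S T)
      continuous_coinduced_rng
  have hcs : @CompactSpace _ (TopologicalSpace.induced
      (Subtype.val : iota '' geodesicSegment S T → BerkLine K) (fineTopology K)) :=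
    @isCompact_iff_compactSpace _ (fineTopology K) _ |>.1 hc
  refine continuous_id_iff_le.1 ?_
  exact (@Continuous.continuous_symm_of_equiv_compact_to_t2 _ _
    (TopologicalSpace.induced Subtype.val (fineTopology K))
    (TopologicalSpace.induced Subtype.val (weakTopology K)) hcs inferInstance (Equiv.refl _)
    (continuous_id_iff_le.2 (induced_mono fineTopology_le_weakTopology)))

/-- The geodesic, rescaled to `[0, 1]` and composed with `iota`, is continuous and injective from a
compact space to a Hausdorff one, hence an embedding. -/
theorem joinedByArc_of_convex {τ : TopologicalSpace (BerkLine K)}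
    (hτ : Continuous[inferInstance, τ] (iota (K := K))) (ht2 : @T2Space _ τ)
    {V : Set (BerkLine K)} (hV : IsGeodesicallyConvex V) {p q : BerkLine K} (hp : p ∈ V)
    (hq : q ∈ V) (hpq : p ≠ q) : JoinedByArc τ V p q := by
  obtain ⟨S, rfl⟩ := iota_surjective p
  obtain ⟨T, rfl⟩ := iota_surjective q
  obtain ⟨γ, h0, h1, hγ⟩ := ProjTree.exists_geodesic S T
  have hd : 0 < dist S T := dist_pos.2 fun h => hpq (h ▸ rfl)
  have hmem : ∀ t : Icc (0 : ℝ) 1, dist S T * t ∈ Icc 0 (dist S T) := fun t =>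
    ⟨mul_nonneg hd.le t.2.1, mul_le_of_le_one_right hd.le t.2.2⟩
  have hcont : Continuous fun t : Icc (0 : ℝ) 1 => γ (dist S T * t) :=
    (continuousOn_of_dist_eq hγ).comp_continuous (by fun_prop) hmem
  have hinj : Function.Injective fun t : Icc (0 : ℝ) 1 => γ (dist S T * t) := fun s t hst => by
    have := hγ _ (hmem s) _ (hmem t)
    rw [show γ (dist S T * s) = γ (dist S T * t) from hst, dist_self, eq_comm, abs_eq_zero,
      sub_eq_zero] at this
    exact Subtype.ext (mul_left_cancel₀ hd.ne' this)
  refine ⟨fun t => iota (γ (dist S T * t)), ?_, ?_, ?_, fun t => ?_⟩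
  · exact (@Continuous.isClosedEmbedding _ _ _ τ _ ht2 _ (@Continuous.comp _ _ _ _ _ τ _ _ hτ hcont)
      (iota_injective.comp hinj)).isEmbedding
  · simp [h0]
  · simp [h1]
  · exact hV _ hp _ hq _ ⟨S, T, rfl, rfl, rfl⟩ ⟨_, ⟨γ, h0, h1, hγ, _, hmem t, rfl⟩, rfl⟩

theorem isGeodesicallyConvex_sInter {𝒱 : Set (Set (BerkLine K))}
    (h : ∀ V ∈ 𝒱, IsGeodesicallyConvex V) : IsGeodesicallyConvex (⋂₀ 𝒱) :=
  fun p hp q hq ℓ hℓ => subset_sInter fun V hV => h V hV p (hp V hV) q (hq V hV) ℓ hℓ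

end Connected

end BerkovichLine

/-! ### The corollary. -/

theorem mainTheorem10 (K : Type*) [NormedField K] [IsUltrametricDist K] [CompleteSpace K]
    [BerkovichLine.AdmissibleField K] :
    -- the two topologies agree on every geodesic segment
    (∀ (p q : BerkovichLine.BerkLine K) (ℓ : Set (BerkovichLine.BerkLine K)),
      BerkovichLine.IsSegment ℓ p q →
        TopologicalSpace.induced (Subtype.val : ℓ → BerkovichLine.BerkLine K)
            (BerkovichLine.weakTopology K) =
          TopologicalSpace.induced (Subtype.val : ℓ → BerkovichLine.BerkLine K)
            (BerkovichLine.fineTopology K)) ∧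
    -- convexity and connectedness for each of the two topologies are equivalent
    (∀ V : Set (BerkovichLine.BerkLine K),
      List.TFAE [BerkovichLine.IsGeodesicallyConvex V,
        @IsPreconnected _ (BerkovichLine.fineTopology K) V,
        @IsPreconnected _ (BerkovichLine.weakTopology K) V]) ∧
    -- for each of the two topologies, connected sets are arc-connected and intersections of
    -- connected sets are connected
    (∀ τ : TopologicalSpace (BerkovichLine.BerkLine K),
      τ = BerkovichLine.weakTopology K ∨ τ = BerkovichLine.fineTopology K →
        (∀ V : Set (BerkovichLine.BerkLine K), @IsPreconnected _ τ V →
          ∀ p ∈ V, ∀ q ∈ V, p ≠ q → BerkovichLine.JoinedByArc τ V p q) ∧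
        ∀ 𝒱 : Set (Set (BerkovichLine.BerkLine K)), (∀ V ∈ 𝒱, @IsPreconnected _ τ V) →
          @IsPreconnected _ τ (⋂₀ 𝒱)) := by
  refine ⟨fun p q ℓ => BerkovichLine.induced_weakTopology_eq_induced_fineTopology,
    BerkovichLine.tfae_convex_isPreconnected, fun τ hτ => ?_⟩
  -- Both topologies are handled together through three properties: `iota` is continuous, the space
  -- is Hausdorff, and connected sets are convex.
  have hcont : @Continuous _ _ inferInstance τ (BerkovichLine.iota (K := K)) := by
    rcases hτ with rfl | rfl
    · exact BerkovichLine.continuous_iota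
    · exact continuous_coinduced_rng
  have ht2 : @T2Space _ τ := by
    rcases hτ with rfl | rfl
    · infer_instance
    · exact BerkovichLine.t2Space_fineTopology
  have hconv : ∀ V, @IsPreconnected _ τ V → BerkovichLine.IsGeodesicallyConvex V := by
    rcases hτ with rfl | rfl
    · exact fun V => ((BerkovichLine.tfae_convex_isPreconnected V).out 2 0).1
    · exact fun V => ((BerkovichLine.tfae_convex_isPreconnected V).out 1 0).1
  exact ⟨fun V hV p hp q hq hpq =>
      BerkovichLine.joinedByArc_of_convex hcont ht2 (hconv V hV) hp hq hpq,
    fun 𝒱 h => (BerkovichLine.isGeodesicallyConvex_sInter fun V hV =>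
      hconv V (h V hV)).isPreconnected hcont⟩
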